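/- Let $k\ge 1$ be an integer. For integers $n\ge 1$, let $\mathbf{G}\in\bigotimes^k\mathbb{R}^n$ be a random tensor with i.i.d. $\mathsf{N}(0,1)$ entries, and let $$\mathbf{Z}=\frac{1}{k!}\sqrt{\frac kn}\sum_{\pi\in\mathfrak{S}_k}\mathbf{G}^{\pi},\qquad \mathbf{G}^\pi_{i_1,\dots,i_k}=\mathbf{G}_{i_{\pi(1)},\dots,i_{\pi(k)}}$$ be the symmetric standard normal noise tensor. For $0\le q\le k$, let $\mathrm{Mat}_q(\mathbf{Z})\in\mathbb{R}^{n^q\times n^{k-q}}$ be the unfolding $[\mathrm{Mat}_q(\mathbf{Z})]_{a,b}=\mathbf{Z}_{i_1,\dots,i_k}$, where $a=1+\sum_{j=1}^q(i_j-1)n^{j-1}$ and $b=1+\sum_{j=q+1}^k(i_j-1)n^{j-q-1}$, and let $\|\cdot\|_{op}$ be the matrix operator norm with respect to the Euclidean norms. Then there is a constant $C_k>0$ depending only on $k$ such that the following hold. (a) For all $n\ge 1$ and all $0\le q\le k$, the random variable $\|\mathrm{Mat}_q(\mathbf{Z})\|_{op}$ is integrable and $$\frac{1}{\sqrt{(k-1)!}}\,n^{\max(q-1,k-q-1)/2}\Big(1-\frac{C_k}{n^{\max(q,k-q)}}\Big)\le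 \mathbb{E}\|\mathrm{Mat}_q(\mathbf{Z})\|_{op}\le \sqrt{k}\,\big(n^{(q-1)/2}+n^{(k-q-1)/2}\big).$$ (b) For all $n$ large enough (depending on $k$), both the lower bound and the upper bound in (a), as functions of $q\in\{0,\dots,k\}$, attain their minimum at $q=\lceil k/2\rceil$. (c) For all $n\ge1$, all $0\le q\le k$ and all $t\ge 0$, $$\mathbb{P}\Big\{\big|\|\mathrm{Mat}_q(\mathbf{Z})\|_{op}-\mathbb{E}\|\mathrm{Mat}_q(\mathbf{Z})\|_{op}\big|\ge t\Big\}\le 2e^{-nt^2/(2k)}.$$ -/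

import Mathlib

open MeasureTheory ProbabilityTheory Filter
open scoped Nat

namespace TensorUnfolding

/-- Real tensors of order `k` on `ℝⁿ`, given by their coordinates `X_{i₁,…,i_k}`. -/
abbrev Tensor (k n : ℕ) : Type := (Fin k → Fin n) → ℝ

/-- The tensor `X^π`, whose entry at `(i₁,…,i_k)` is the entry of `X` at `(i_{π(1)},…,i_{π(k)})`. -/
def permute {k n : ℕ} (π : Equiv.Perm (Fin k)) (X : Tensor k n) : Tensor k n :=
  fun i => X (fun j => i (π j))

/-- The symmetrized and rescaled tensor `(1/k!) √(k/n) ∑_π G^π`. It is the symmetric standard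
normal noise tensor when `G` has independent standard normal entries. -/
noncomputable def symNoise {k n : ℕ} (G : Tensor k n) : Tensor k n :=
  (1 / (k ! : ℝ) * √((k : ℝ) / (n : ℝ))) • ∑ π : Equiv.Perm (Fin k), permute π G

/-- `G` is, under the measure `P`, a random tensor with independent `N(0,1)` entries. -/
structure IsStdGaussianTensor {Ω : Type*} [MeasurableSpace Ω] {k n : ℕ}
    (G : Ω → Tensor k n) (P : Measure Ω) : Prop where
  hasLaw : ∀ i : Fin k → Fin n, HasLaw (fun ω => G ω i) (gaussianReal 0 1) P
  indep : iIndepFun (fun (i : Fin k → Fin n) (ω : Ω) => G ω i) P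

/-- The unfolding `Mat_q : ⊗ᵏ ℝⁿ → ℝ^{n^q × n^{k-q}}` (for `q ≤ k`). The first `q` indices of the
tensor are the base-`n` digits of the row index and the last `k - q` indices are those of the
column index: `finFunctionFinEquiv` sends `f` to `∑ j, f j * n ^ j` (everything is numbered
from `0`). -/
def unfolding {k n : ℕ} (q : ℕ) (X : Tensor k n) : Matrix (Fin (n ^ q)) (Fin (n ^ (k - q))) ℝ :=
  Matrix.of fun a b => X fun j : Fin k =>
    if h : (j : ℕ) < q then finFunctionFinEquiv.symm a ⟨j, h⟩
    else finFunctionFinEquiv.symm b ⟨j - q, by omega⟩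

/-- The operator norm of a matrix with respect to the Euclidean norms (largest singular value). -/
noncomputable def opNorm {m p : ℕ} (A : Matrix (Fin m) (Fin p) ℝ) : ℝ :=
  ‖LinearMap.toContinuousLinearMap (Matrix.toEuclideanLin A)‖

/-- `‖Mat_q(Z)‖_op`, where `Z` is the symmetric noise tensor built from `G`. -/
noncomputable def noiseNorm {k n : ℕ} (q : ℕ) (G : Tensor k n) : ℝ :=
  opNorm (unfolding q (symNoise G))

/-- `(1/√((k-1)!)) n^{max(q-1, k-q-1)/2} (1 - C / n^{max(q, k-q)})`, for `1 ≤ k`. -/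
noncomputable def lowerBound (C : ℝ) (k n q : ℕ) : ℝ :=
  1 / √((k - 1)! : ℝ) * (n : ℝ) ^ (max ((q : ℝ) - 1) ((k : ℝ) - q - 1) / 2) *
    (1 - C / (n : ℝ) ^ max (q : ℝ) ((k : ℝ) - q))

/-- `√k (n^{(q-1)/2} + n^{(k-q-1)/2})`. -/
noncomputable def upperBound (k n q : ℕ) : ℝ :=
  √(k : ℝ) * ((n : ℝ) ^ (((q : ℝ) - 1) / 2) + (n : ℝ) ^ (((k : ℝ) - q - 1) / 2))

end TensorUnfolding

set_option linter.unusedSectionVars false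

/-! Symmetrization and rescaling form a self-adjoint map S (`symNoiseL2`) on tensors with norm at
most √(k/n), being √(k/n) times an average of isometries. Hence ‖Mat_q(Z)‖ is the supremum over unit
vectors u, v of the Gaussian linear forms ⟪S(u ⊗ v), G⟫, whose coefficient vectors have norm at most
√(k/n). A countable dense family of pairs suffices (`exists_isLUB_noiseNorm`), and everything
reduces to suprema of Gaussian linear forms.

Concentration: such a supremum is sub-Gaussian with variance proxy k/n
(`hasSubgaussianMGF_of_isLUB`), which gives the tail bound.

Upper bound: by Sudakov-Fernique (`integral_le_of_norm_sub_le`), the family S(u ⊗ v) is compared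
with √(k/n) (u, v) in the direct sum. Its increments are larger, and its supremum is at most
√(k/n)(|g| + |h|) for standard Gaussian vectors g, h of dimensions n^q and n^(k-q).

Lower bound: the operator norm dominates every row and column, and each entry of Z has variance at
least 1/(n (k-1)!), so the second moment is at least n^max(q,k-q)/(n (k-1)!). Concentration limits
the variance to 4k/n, so the squared mean is nearly as large.

Both Gaussian tools come from one device. The maximum is smoothed by `logSumExp`, the Gaussian is
cut into m independent increments of size 1/√m, and each increment is expanded to second order with
error O(m^(-3/2)), so the total error vanishes as m → ∞. -/

namespace TensorUnfolding

/-! ### Taylor expansions of log-sum-exp with global remainder bounds. -/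

section LogSumExp

variable {A : Type*} [Fintype A]

/-- Second order expansion of the cumulant generating function of a finite distribution. -/
lemma abs_log_sum_mul_exp_sub_le {p y : A → ℝ} {R : ℝ} (hp : ∀ a, 0 ≤ p a)
    (hp1 : ∑ a, p a = 1) (hy : ∀ a, |y a| ≤ R) :
    |Real.log (∑ a, p a * Real.exp (y a)) - ∑ a, p a * y a -
      (∑ a, p a * y a ^ 2 - (∑ a, p a * y a) ^ 2) / 2| ≤ 10 * R ^ 3 := by
  have hR : 0 ≤ R := by
    have : (Finset.univ : Finset A).Nonempty := by
      by_contra h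
      rw [Finset.not_nonempty_iff_eq_empty] at h
      simp [h] at hp1
    obtain ⟨a, -⟩ := this
    exact (abs_nonneg _).trans (hy a)
  have avg : ∀ (f : A → ℝ) (c : ℝ), (∀ a, |f a| ≤ c) → |∑ a, p a * f a| ≤ c := by
    intro f c hf
    calc |∑ a, p a * f a| ≤ ∑ a, p a * c := by
          refine (Finset.abs_sum_le_sum_abs _ _).trans (Finset.sum_le_sum fun a _ => ?_)
          rw [abs_mul, abs_of_nonneg (hp a)]
          exact mul_le_mul_of_nonneg_left (hf a) (hp a)
      _ = c := by rw [← Finset.sum_mul, hp1, one_mul]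
  set m := ∑ a, p a * y a with hm
  set q := ∑ a, p a * y a ^ 2 with hq
  have hmR : |m| ≤ R := avg y R hy
  have hqR : |q| ≤ R ^ 2 := avg _ _ fun a => by
    rw [abs_pow]; exact pow_le_pow_left₀ (abs_nonneg _) (hy a) 2
  have hq0 : 0 ≤ q := Finset.sum_nonneg fun a _ => mul_nonneg (hp a) (sq_nonneg _)
  rw [abs_of_nonneg hq0] at hqR
  obtain ⟨hm1, hm2⟩ := abs_le.1 hmR
  -- Taylor expansion handles small R. For R ≥ 1/2 each term is at most a multiple of R or R², which
  -- R³ absorbs. No smallness of R may be assumed, since R will be a multiple of the norm of an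
  -- unbounded Gaussian increment.
  rcases le_total R (1 / 2) with hR2 | hR2
  · set r := ∑ a, p a * (Real.exp (y a) - (1 + y a + y a ^ 2 / 2)) with hr
    have hrR : |r| ≤ 2 / 9 * R ^ 3 := avg _ _ fun a => by
      have h := Real.exp_bound (x := y a) ((hy a).trans (by linarith)) (n := 3) (by norm_num)
      simp only [Finset.sum_range_succ, Finset.sum_range_zero, Nat.factorial] at h
      norm_num at h
      have h2 : |y a| ^ 3 ≤ R ^ 3 := pow_le_pow_left₀ (abs_nonneg _) (hy a) 3
      linarith
    have hsum : ∑ a, p a * Real.exp (y a) = 1 + (m + q / 2 + r) := by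
      have h1 : 1 + (m + q / 2 + r) = ∑ a, p a + (m + q / 2 + r) := by rw [hp1]
      rw [h1, hr, hm, hq, Finset.sum_div, ← Finset.sum_add_distrib, ← Finset.sum_add_distrib,
        ← Finset.sum_add_distrib]
      exact Finset.sum_congr rfl fun a _ => by ring
    obtain ⟨hr1, hr2⟩ := abs_le.1 hrR
    have hR3 : R ^ 3 ≤ R ^ 2 / 2 := by nlinarith [sq_nonneg R]
    have hR4 : R ^ 2 ≤ R / 2 := by nlinarith
    set z := m + q / 2 + r with hz
    have hzR : |z| ≤ 4 / 3 * R := abs_le.2 ⟨by linarith, by linarith⟩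
    have hz1 : |z| ≤ 2 / 3 := by linarith
    have hlog : |Real.log (1 + z) - z + z ^ 2 / 2| ≤ 64 / 9 * R ^ 3 := by
      have h := Real.abs_log_sub_add_sum_range_le (x := -z) (by rw [abs_neg]; linarith) 2
      simp only [Finset.sum_range_succ, Finset.sum_range_zero, abs_neg] at h
      norm_num at h
      have h3 : |z| ^ 3 ≤ (4 / 3 * R) ^ 3 := pow_le_pow_left₀ (abs_nonneg _) hzR 3
      -- Since |z| ≤ 2/3, the denominator costs a factor 3, and 3 · (4/3)³ = 64/9.
      have h4 : |z| ^ 3 / (1 - |z|) ≤ 64 / 9 * R ^ 3 := by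
        rw [div_le_iff₀ (by linarith)]
        have : 0 ≤ R ^ 3 := by positivity
        nlinarith
      have h5 : Real.log (1 + z) - z + z ^ 2 / 2 = -z + z ^ 2 / 2 + Real.log (1 + z) := by ring
      rw [h5]
      exact h.trans h4
    have hzm : |z ^ 2 - m ^ 2| ≤ 5 / 3 * R ^ 3 := by
      have h1 : z ^ 2 - m ^ 2 = (q / 2 + r) * (z + m) := by rw [hz]; ring
      rw [h1, abs_mul]
      have h2 : |q / 2 + r| ≤ 11 / 18 * R ^ 2 := abs_le.2 ⟨by linarith, by linarith⟩
      have h3 : |z + m| ≤ 7 / 3 * R := (abs_add_le _ _).trans (by linarith)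
      calc |q / 2 + r| * |z + m| ≤ (11 / 18 * R ^ 2) * (7 / 3 * R) :=
            mul_le_mul h2 h3 (abs_nonneg _) (by positivity)
        _ ≤ 5 / 3 * R ^ 3 := by nlinarith [pow_nonneg hR 3]
    rw [hsum]
    obtain ⟨hl1, hl2⟩ := abs_le.1 hlog
    obtain ⟨hs1, hs2⟩ := abs_le.1 hzm
    have hR3' : 0 ≤ R ^ 3 := by positivity
    refine abs_le.2 ⟨?_, ?_⟩ <;> linarith
  · have hpos : Real.exp (-R) ≤ ∑ a, p a * Real.exp (y a) := by
      calc Real.exp (-R) = ∑ a, p a * Real.exp (-R) := by rw [← Finset.sum_mul, hp1, one_mul]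
        _ ≤ _ := Finset.sum_le_sum fun a _ => mul_le_mul_of_nonneg_left
            (Real.exp_le_exp.2 (abs_le.1 (hy a)).1) (hp a)
    have hle : ∑ a, p a * Real.exp (y a) ≤ Real.exp R := by
      calc _ ≤ ∑ a, p a * Real.exp R := Finset.sum_le_sum fun a _ => mul_le_mul_of_nonneg_left
            (Real.exp_le_exp.2 (abs_le.1 (hy a)).2) (hp a)
        _ = _ := by rw [← Finset.sum_mul, hp1, one_mul]
    have h1 : -R ≤ Real.log (∑ a, p a * Real.exp (y a)) :=
      (Real.le_log_iff_exp_le ((Real.exp_pos _).trans_le hpos)).2 hpos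
    have h2 : Real.log (∑ a, p a * Real.exp (y a)) ≤ R :=
      (Real.log_le_iff_le_exp ((Real.exp_pos _).trans_le hpos)).2 hle
    have h3 : m ^ 2 ≤ R ^ 2 := by nlinarith
    have h4 : R ≤ 4 * R ^ 3 := by nlinarith [mul_nonneg hR (sub_nonneg.2 hR2), sq_nonneg R]
    have h5 : R ^ 2 ≤ 2 * R ^ 3 := by nlinarith [sq_nonneg R]
    have h6 := sq_nonneg m
    refine abs_le.2 ⟨?_, ?_⟩ <;> linarith

/-- The function `log ∑ exp`. -/
noncomputable def logSumExp (w : A → ℝ) : ℝ := Real.log (∑ a, Real.exp (w a))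

/-- The gradient of `log ∑ exp`. -/
noncomputable def softmax (w : A → ℝ) (a : A) : ℝ := Real.exp (w a) / ∑ b, Real.exp (w b)

/-- A variance is half the mean squared difference of two independent copies. In this form the
second-order term sees only the differences y a - y b, the quantities that Sudakov-Fernique
compares. -/
lemma sum_sq_sub_sq_sum_eq {p : A → ℝ} (hp1 : ∑ a, p a = 1) (y : A → ℝ) :
    (∑ a, p a * y a ^ 2 - (∑ a, p a * y a) ^ 2) / 2 =
      (∑ a, ∑ b, p a * p b * (y a - y b) ^ 2) / 4 := by
  have h1 : ∀ a b, p a * p b * (y a - y b) ^ 2 =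
      p b * (p a * y a ^ 2) - 2 * ((p a * y a) * (p b * y b)) + p a * (p b * y b ^ 2) := by
    intro a b; ring
  simp only [h1, Finset.sum_add_distrib, Finset.sum_sub_distrib, ← Finset.mul_sum,
    ← Finset.sum_mul, hp1]
  ring

variable [Nonempty A]

lemma sum_exp_pos (w : A → ℝ) : 0 < ∑ a, Real.exp (w a) :=
  Finset.sum_pos (fun _ _ => Real.exp_pos _) Finset.univ_nonempty

lemma softmax_nonneg (w : A → ℝ) (a : A) : 0 ≤ softmax w a :=
  div_nonneg (Real.exp_pos _).le (sum_exp_pos w).le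

lemma sum_softmax (w : A → ℝ) : ∑ a, softmax w a = 1 := by
  simp only [softmax, ← Finset.sum_div]
  exact div_self (sum_exp_pos w).ne'

@[fun_prop]
lemma continuous_softmax (a : A) : Continuous fun w : A → ℝ => softmax w a := by
  unfold softmax
  exact (by fun_prop : Continuous fun w : A → ℝ => Real.exp (w a)).div (by fun_prop)
    fun w => (sum_exp_pos w).ne'

@[fun_prop]
lemma continuous_logSumExp : Continuous (logSumExp : (A → ℝ) → ℝ) := by
  unfold logSumExp
  exact Continuous.log (by fun_prop) fun w => (sum_exp_pos w).ne'

lemma logSumExp_add (w y : A → ℝ) :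
    logSumExp (w + y) = logSumExp w + Real.log (∑ a, softmax w a * Real.exp (y a)) := by
  have h : ∑ a, softmax w a * Real.exp (y a) =
      (∑ a, Real.exp ((w + y) a)) / ∑ b, Real.exp (w b) := by
    rw [Finset.sum_div]
    refine Finset.sum_congr rfl fun a _ => ?_
    rw [softmax, Pi.add_apply, Real.exp_add]
    ring
  rw [h, Real.log_div (sum_exp_pos _).ne' (sum_exp_pos _).ne', logSumExp, logSumExp]
  ring

lemma le_logSumExp (w : A → ℝ) (a : A) : w a ≤ logSumExp w := by
  rw [logSumExp, Real.le_log_iff_exp_le (sum_exp_pos w)]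
  exact Finset.single_le_sum (f := fun a => Real.exp (w a)) (fun _ _ => (Real.exp_pos _).le)
    (Finset.mem_univ a)

lemma logSumExp_le {w : A → ℝ} {c : ℝ} (h : ∀ a, w a ≤ c) :
    logSumExp w ≤ c + Real.log (Fintype.card A) := by
  have hA : (0 : ℝ) < Fintype.card A := by exact_mod_cast Fintype.card_pos
  rw [logSumExp, Real.log_le_iff_le_exp (sum_exp_pos w), Real.exp_add, Real.exp_log hA]
  calc _ ≤ ∑ _a : A, Real.exp c := Finset.sum_le_sum fun a _ => Real.exp_le_exp.2 (h a)
    _ = _ := by simp [mul_comm]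

lemma abs_logSumExp_add_sub_le {w y : A → ℝ} {R : ℝ} (hy : ∀ a, |y a| ≤ R) :
    |logSumExp (w + y) - logSumExp w| ≤ R := by
  have key : ∀ {u z : A → ℝ}, (∀ a, |z a| ≤ R) → logSumExp (u + z) ≤ logSumExp u + R := by
    intro u z hz
    rw [logSumExp, logSumExp, Real.log_le_iff_le_exp (sum_exp_pos _), Real.exp_add,
      Real.exp_log (sum_exp_pos _), Finset.sum_mul]
    refine Finset.sum_le_sum fun a _ => ?_
    rw [← Real.exp_add]
    exact Real.exp_le_exp.2 (add_le_add_right (abs_le.1 (hz a)).2 _)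
  have h1 := key (u := w) hy
  have h2 := key (u := w + y) (z := -y) (by simpa using hy)
  rw [add_neg_cancel_right] at h2
  exact abs_le.2 ⟨by linarith, by linarith⟩

lemma abs_logSumExp_add_sub_sub_le {w y : A → ℝ} {R : ℝ} (hy : ∀ a, |y a| ≤ R) :
    |logSumExp (w + y) - logSumExp w - ∑ a, softmax w a * y a -
      (∑ a, ∑ b, softmax w a * softmax w b * (y a - y b) ^ 2) / 4| ≤ 10 * R ^ 3 := by
  rw [← sum_sq_sub_sq_sum_eq (sum_softmax w), logSumExp_add, add_sub_cancel_left]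
  exact abs_log_sum_mul_exp_sub_le (softmax_nonneg w) (sum_softmax w) hy

lemma abs_sum_softmax_mul_le {w y : A → ℝ} {R : ℝ} (hy : ∀ a, |y a| ≤ R) :
    |∑ a, softmax w a * y a| ≤ R := by
  calc |∑ a, softmax w a * y a| ≤ ∑ a, softmax w a * R := by
        refine (Finset.abs_sum_le_sum_abs _ _).trans (Finset.sum_le_sum fun a _ => ?_)
        rw [abs_mul, abs_of_nonneg (softmax_nonneg w a)]
        exact mul_le_mul_of_nonneg_left (hy a) (softmax_nonneg w a)
    _ = R := by rw [← Finset.sum_mul, sum_softmax, one_mul]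

/-- Follows from the third-order expansion for R ≤ 1, and from the Lipschitz bound 2R ≤ 11R² for R ≥
1. -/
lemma abs_logSumExp_add_sub_sub_le_sq {w y : A → ℝ} {R : ℝ} (hy : ∀ a, |y a| ≤ R) :
    |logSumExp (w + y) - logSumExp w - ∑ a, softmax w a * y a| ≤ 11 * R ^ 2 := by
  have hR : 0 ≤ R := (abs_nonneg _).trans (hy (Classical.arbitrary A))
  have h2 := abs_sum_softmax_mul_le (w := w) hy
  rcases le_total R 1 with hR1 | hR1
  · have h := abs_log_sum_mul_exp_sub_le (softmax_nonneg w) (sum_softmax w) hy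
    have h3 : |∑ a, softmax w a * y a ^ 2| ≤ R ^ 2 :=
      abs_sum_softmax_mul_le fun a => by
        rw [abs_pow]; exact pow_le_pow_left₀ (abs_nonneg _) (hy a) 2
    rw [logSumExp_add, add_sub_cancel_left]
    have h4 : R ^ 3 ≤ R ^ 2 := pow_le_pow_of_le_one hR hR1 (by norm_num)
    have h5 : (∑ a, softmax w a * y a) ^ 2 ≤ R ^ 2 := sq_le_sq' (abs_le.1 h2).1 (abs_le.1 h2).2
    have h6 := sq_nonneg (∑ a, softmax w a * y a)
    obtain ⟨h7, h8⟩ := abs_le.1 h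
    obtain ⟨h9, h10⟩ := abs_le.1 h3
    exact abs_le.2 ⟨by linarith, by linarith⟩
  · have h1 := abs_logSumExp_add_sub_le (w := w) hy
    calc _ ≤ |logSumExp (w + y) - logSumExp w| + |∑ a, softmax w a * y a| := abs_sub _ _
      _ ≤ 11 * R ^ 2 := by nlinarith

end LogSumExp

/-! ### Isotropic Gaussian measures: convolution, moments, integrability. -/

section ScaledGaussian

open scoped RealInnerProductSpace

variable {E : Type*} [NormedAddCommGroup E] [InnerProductSpace ℝ E] [FiniteDimensional ℝ E]
  [MeasurableSpace E]

/-- The centered Gaussian measure with covariance `c ^ 2` times the identity. -/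
noncomputable def scaledGaussian (E : Type*) [NormedAddCommGroup E] [InnerProductSpace ℝ E]
    [FiniteDimensional ℝ E] [MeasurableSpace E] (c : ℝ) : Measure E :=
  (stdGaussian E).map (c • ·)

lemma scaledGaussian_one : scaledGaussian E 1 = stdGaussian E := by
  simp [scaledGaussian]

variable [BorelSpace E]

lemma scaledGaussian_zero : scaledGaussian E 0 = Measure.dirac 0 := by
  simp [scaledGaussian]

instance isProbabilityMeasure_scaledGaussian (c : ℝ) :
    IsProbabilityMeasure (scaledGaussian E c) :=
  Measure.isProbabilityMeasure_map (Measurable.aemeasurable (by fun_prop))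

lemma charFun_scaledGaussian (c : ℝ) (t : E) :
    charFun (scaledGaussian E c) t = Complex.exp (-(c ^ 2 * ‖t‖ ^ 2) / 2) := by
  rw [scaledGaussian, charFun_map_smul, charFun_stdGaussian, norm_smul]
  congr 1
  norm_cast
  rw [mul_pow, Real.norm_eq_abs, sq_abs]

/-- Variances add: mc² + c² = (m + 1)c². This is what allows a standard Gaussian to be built from
small independent increments. -/
lemma scaledGaussian_conv_sqrt (m : ℕ) (c : ℝ) :
    scaledGaussian E (√m * c) ∗ scaledGaussian E c = scaledGaussian E (√(m + 1 : ℕ) * c) := by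
  refine Measure.ext_of_charFun ?_
  ext t
  rw [charFun_conv, charFun_scaledGaussian, charFun_scaledGaussian, charFun_scaledGaussian,
    ← Complex.exp_add]
  congr 1
  norm_cast
  rw [mul_pow, mul_pow, Real.sq_sqrt (by positivity), Real.sq_sqrt (by positivity)]
  push_cast
  ring

lemma integral_scaledGaussian (c : ℝ) {f : E → ℝ} (hf : Continuous f) :
    ∫ x, f x ∂(scaledGaussian E c) = ∫ x, f (c • x) ∂(stdGaussian E) := by
  rw [scaledGaussian, integral_map (Measurable.aemeasurable (by fun_prop))
    hf.aestronglyMeasurable]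

/-- Fernique's theorem gives a finite moment of exp(C‖x‖²), which dominates exp(a‖x‖) after
completing the square. -/
lemma integrable_exp_mul_norm_stdGaussian (a : ℝ) :
    Integrable (fun x : E => Real.exp (a * ‖x‖)) (stdGaussian E) := by
  obtain ⟨C, hC, h⟩ := IsGaussian.exists_integrable_exp_sq (stdGaussian E)
  refine (h.const_mul (Real.exp (a ^ 2 / (4 * C)))).mono'
    (Continuous.aestronglyMeasurable (by fun_prop)) (ae_of_all _ fun x => ?_)
  rw [Real.norm_of_nonneg (Real.exp_pos _).le, ← Real.exp_add, Real.exp_le_exp]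
  have h1 : a ^ 2 / (4 * C) + C * ‖x‖ ^ 2 - a * ‖x‖ = (a - 2 * C * ‖x‖) ^ 2 / (4 * C) := by
    field_simp
    ring
  have h2 : 0 ≤ (a - 2 * C * ‖x‖) ^ 2 / (4 * C) := by positivity
  linarith

lemma integrable_exp_mul_norm_scaledGaussian (a c : ℝ) :
    Integrable (fun x : E => Real.exp (a * ‖x‖)) (scaledGaussian E c) := by
  rw [scaledGaussian, integrable_map_measure (Continuous.aestronglyMeasurable (by fun_prop))
    (Measurable.aemeasurable (by fun_prop))]
  refine (integrable_exp_mul_norm_stdGaussian (E := E) (a * |c|)).congr (ae_of_all _ fun x => ?_)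
  simp [norm_smul, mul_assoc]

lemma integrable_pow_norm_scaledGaussian (c : ℝ) (j : ℕ) :
    Integrable (fun x : E => ‖x‖ ^ j) (scaledGaussian E c) := by
  refine ((integrable_exp_mul_norm_scaledGaussian (E := E) 1 c).const_mul (j ! : ℝ)).mono'
    (Continuous.aestronglyMeasurable (by fun_prop)) (ae_of_all _ fun x => ?_)
  rw [Real.norm_of_nonneg (by positivity), one_mul]
  have h := Real.pow_div_factorial_le_exp _ (norm_nonneg x) j
  rwa [div_le_iff₀' (by positivity)] at h

lemma integrable_of_abs_le_norm {c a b : ℝ} {f : E → ℝ} (hf : Continuous f)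
    (h : ∀ x, |f x| ≤ a + b * ‖x‖) : Integrable f (scaledGaussian E c) := by
  have h1 : Integrable (fun x : E => ‖x‖) (scaledGaussian E c) := by
    simpa using integrable_pow_norm_scaledGaussian (E := E) c 1
  exact ((integrable_const a).add (h1.const_mul b)).mono'
    hf.aestronglyMeasurable (ae_of_all _ h)

lemma integral_inner_stdGaussian (t : E) : ∫ x, ⟪t, x⟫ ∂(stdGaussian E) = 0 :=
  integral_strongDual_stdGaussian (innerSL ℝ t)

lemma integral_inner_sq_stdGaussian (t : E) :
    ∫ x, ⟪t, x⟫ ^ 2 ∂(stdGaussian E) = ‖t‖ ^ 2 := by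
  have h := variance_dual_stdGaussian (innerSL ℝ t)
  rw [variance_of_integral_eq_zero (by fun_prop) (integral_strongDual_stdGaussian _),
    innerSL_apply_norm] at h
  simpa using h

end ScaledGaussian

/-! ### Sharp exponential moments of smooth Lipschitz functions of a Gaussian vector. -/

section Concentration

open scoped RealInnerProductSpace

variable {E : Type*} [NormedAddCommGroup E] [InnerProductSpace ℝ E]

/-- `h` is `L`-Lipschitz and has first order expansions with quadratic remainder. -/
def IsSmoothLipschitz (L B : ℝ) (h : E → ℝ) : Prop :=
  ∃ v : E → E, Continuous v ∧ (∀ x, ‖v x‖ ≤ L) ∧ (∀ x y, |h (x + y) - h x| ≤ L * ‖y‖) ∧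
    ∀ x y, |h (x + y) - h x - ⟪v x, y⟫| ≤ B * ‖y‖ ^ 2

lemma IsSmoothLipschitz.continuous {L B : ℝ} {h : E → ℝ} (hh : IsSmoothLipschitz L B h) :
    Continuous h := by
  obtain ⟨v, -, -, hL, -⟩ := hh
  refine (LipschitzWith.of_dist_le_mul (K := L.toNNReal) fun x y => ?_).continuous
  have := hL y (x - y)
  rw [add_sub_cancel] at this
  rw [Real.dist_eq, dist_eq_norm]
  exact this.trans (mul_le_mul_of_nonneg_right (Real.le_coe_toNNReal L) (norm_nonneg _))

lemma IsSmoothLipschitz.const_mul {L B : ℝ} {h : E → ℝ} (hh : IsSmoothLipschitz L B h) (c : ℝ) :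
    IsSmoothLipschitz (|c| * L) (|c| * B) fun x => c * h x := by
  obtain ⟨v, hc, hv, hL, hB⟩ := hh
  refine ⟨fun x => c • v x, by fun_prop, fun x => ?_, fun x y => ?_, fun x y => ?_⟩
  · rw [norm_smul, Real.norm_eq_abs]
    exact mul_le_mul_of_nonneg_left (hv x) (abs_nonneg c)
  · rw [← mul_sub, abs_mul, mul_assoc]
    exact mul_le_mul_of_nonneg_left (hL x y) (abs_nonneg c)
  · rw [real_inner_smul_left, ← mul_sub, ← mul_sub, abs_mul, mul_assoc]
    exact mul_le_mul_of_nonneg_left (hB x y) (abs_nonneg c)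

lemma IsSmoothLipschitz.abs_le {L B : ℝ} {h : E → ℝ} (hh : IsSmoothLipschitz L B h) (x : E) :
    |h x| ≤ |h 0| + L * ‖x‖ := by
  obtain ⟨v, -, -, hL, -⟩ := hh
  have h1 := hL 0 x
  rw [zero_add] at h1
  have := abs_sub_abs_le_abs_sub (h x) (h 0)
  linarith

lemma IsSmoothLipschitz.nonneg {L B : ℝ} {h : E → ℝ} (hh : IsSmoothLipschitz L B h) : 0 ≤ L := by
  obtain ⟨v, -, hv, -, -⟩ := hh
  exact (norm_nonneg _).trans (hv 0)

lemma IsSmoothLipschitz.comp_add {L B : ℝ} {h : E → ℝ} (hh : IsSmoothLipschitz L B h) (x : E) :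
    IsSmoothLipschitz L B fun z => h (x + z) := by
  obtain ⟨v, hc, hv, hL, hB⟩ := hh
  exact ⟨fun z => v (x + z), by fun_prop, fun z => hv _, fun z y => by
    simpa only [add_assoc] using hL (x + z) y, fun z y => by
    simpa only [add_assoc] using hB (x + z) y⟩

/-- The factor exp |y| in the remainder removes any restriction on y, so the bound can be integrated
against a Gaussian. -/
lemma exp_le_quadratic_add (y : ℝ) :
    Real.exp y ≤ 1 + y + y ^ 2 / 2 + |y| ^ 3 * Real.exp |y| := by
  have h := Complex.norm_exp_sub_sum_le_norm_mul_exp (y : ℂ) 3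
  rw [Complex.norm_real, Real.norm_eq_abs] at h
  have h2 : Complex.exp y - ∑ m ∈ Finset.range 3, (y : ℂ) ^ m / m ! =
      ((Real.exp y - (1 + y + y ^ 2 / 2) : ℝ) : ℂ) := by
    simp [Finset.sum_range_succ, Nat.factorial]
  rw [h2, Complex.norm_real, Real.norm_eq_abs] at h
  have := (le_abs_self _).trans h
  linarith

variable [FiniteDimensional ℝ E] [MeasurableSpace E] [BorelSpace E]

lemma IsSmoothLipschitz.integrable {L B : ℝ} {h : E → ℝ} (hh : IsSmoothLipschitz L B h) (c : ℝ) :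
    Integrable h (scaledGaussian E c) :=
  integrable_of_abs_le_norm hh.continuous hh.abs_le

lemma IsSmoothLipschitz.integrable_exp {L B : ℝ} {h : E → ℝ} (hh : IsSmoothLipschitz L B h)
    (c : ℝ) : Integrable (fun x => Real.exp (h x)) (scaledGaussian E c) := by
  have hcont := hh.continuous
  refine ((integrable_exp_mul_norm_scaledGaussian (E := E) L c).const_mul
    (Real.exp |h 0|)).mono' (Continuous.aestronglyMeasurable (by fun_prop))
    (ae_of_all _ fun x => ?_)
  rw [Real.norm_of_nonneg (Real.exp_pos _).le, ← Real.exp_add, Real.exp_le_exp]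
  exact (le_abs_self _).trans (hh.abs_le x)

/-- Averaging over translations preserves `IsSmoothLipschitz`. -/
lemma IsSmoothLipschitz.average {L B : ℝ} {h : E → ℝ} (hh : IsSmoothLipschitz L B h) (c : ℝ) :
    IsSmoothLipschitz L B fun x => ∫ z, h (x + z) ∂(scaledGaussian E c) := by
  have hint : ∀ x, Integrable (fun z => h (x + z)) (scaledGaussian E c) :=
    fun x => (hh.comp_add x).integrable c
  obtain ⟨v, hc, hv, hL, hB⟩ := hh
  have hvint : ∀ x, Integrable (fun z => v (x + z)) (scaledGaussian E c) := fun x =>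
    (integrable_const L).mono' (Continuous.aestronglyMeasurable (by fun_prop))
      (ae_of_all _ fun z => hv _)
  have havg : ∀ {f : E → ℝ} {a : ℝ}, (∀ z, |f z| ≤ a) → |∫ z, f z ∂(scaledGaussian E c)| ≤ a := by
    intro f a hf
    simpa using norm_integral_le_of_norm_le_const (μ := scaledGaussian E c)
      (f := f) (C := a) (ae_of_all _ hf)
  refine ⟨fun x => ∫ z, v (x + z) ∂(scaledGaussian E c), ?_, fun x => ?_, fun x y => ?_,
    fun x y => ?_⟩
  · exact continuous_of_dominated (bound := fun _ => L)
      (fun x => (hvint x).aestronglyMeasurable) (fun x => ae_of_all _ fun z => hv _)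
      (integrable_const L) (ae_of_all _ fun z => by fun_prop)
  · simpa using norm_integral_le_of_norm_le_const (μ := scaledGaussian E c)
      (ae_of_all _ fun z => hv (x + z))
  · rw [← integral_sub (hint _) (hint _)]
    refine havg fun z => ?_
    rw [add_right_comm]
    exact hL _ _
  · have h1 : Integrable (fun z => h (x + y + z) - h (x + z)) (scaledGaussian E c) :=
      (hint _).sub (hint _)
    rw [real_inner_comm, ← integral_inner (hvint x), ← integral_sub (hint _) (hint _),
      ← integral_sub h1 ((hvint x).const_inner y)]
    refine havg fun z => ?_
    rw [add_right_comm, real_inner_comm]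
    exact hB _ _

/-- The exponential moment of a smooth Lipschitz function under a small Gaussian increment. -/
lemma exists_integral_exp_le {L B : ℝ} (hL0 : 0 ≤ L) (hB0 : 0 ≤ B) :
    ∃ K : ℝ, 0 ≤ K ∧ ∀ h : E → ℝ, IsSmoothLipschitz L B h → ∀ ε : ℝ, 0 ≤ ε → ε ≤ 1 →
      ∫ z, Real.exp (h z) ∂(scaledGaussian E ε) ≤
        Real.exp (∫ z, h z ∂(scaledGaussian E ε) + (ε ^ 2 * (L ^ 2 / 2) + ε ^ 3 * K)) := by
  -- Ψ collects all contributions of order ε³, and K is its integral. It depends on h only through L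
  -- and B, so the same K serves for every averaged function met in the iteration.
  set Ψ : E → ℝ := fun g => L * B * ‖g‖ ^ 3 + B ^ 2 / 2 * ‖g‖ ^ 4 +
    6 * L ^ 3 * Real.exp ((L + 1) * ‖g‖) with hΨ
  have hpow : ∀ j, Integrable (fun x : E => ‖x‖ ^ j) (stdGaussian E) := fun j => by
    rw [← scaledGaussian_one]; exact integrable_pow_norm_scaledGaussian 1 j
  have hΨint : Integrable Ψ (stdGaussian E) :=
    (((hpow 3).const_mul _).add ((hpow 4).const_mul _)).add
      ((integrable_exp_mul_norm_stdGaussian _).const_mul _)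
  refine ⟨∫ g, Ψ g ∂(stdGaussian E), integral_nonneg fun g => by positivity, ?_⟩
  intro h hh ε hε0 hε1
  have hcont := hh.continuous
  have hint := hh.integrable ε
  have hinte := hh.integrable_exp ε
  obtain ⟨v, -, hv, hL, hB⟩ := hh
  rw [scaledGaussian, integrable_map_measure hcont.aestronglyMeasurable (by fun_prop)] at hint
  rw [scaledGaussian, integrable_map_measure (Continuous.aestronglyMeasurable (by fun_prop))
    (by fun_prop)] at hinte
  rw [integral_scaledGaussian ε hcont, integral_scaledGaussian ε (by fun_prop)]
  have hin2 : Integrable (fun g => ⟪v 0, g⟫ ^ 2) (stdGaussian E) := by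
    refine ((hpow 2).const_mul (L ^ 2)).mono' (Continuous.aestronglyMeasurable (by fun_prop))
      (ae_of_all _ fun g => ?_)
    rw [Real.norm_of_nonneg (sq_nonneg _), ← mul_pow, ← sq_abs ⟪v 0, g⟫]
    exact pow_le_pow_left₀ (abs_nonneg _) ((abs_real_inner_le_norm _ _).trans
      (mul_le_mul_of_nonneg_right (hv 0) (norm_nonneg _))) 2
  have hpt : ∀ g, Real.exp (h (ε • g)) ≤ Real.exp (h 0) *
      (1 + (h (ε • g) - h 0) + (ε ^ 2 / 2 * ⟪v 0, g⟫ ^ 2 + ε ^ 3 * Ψ g)) := by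
    intro g
    have h1 := hL 0 (ε • g)
    have h2 := hB 0 (ε • g)
    rw [zero_add, norm_smul, Real.norm_of_nonneg hε0] at h1 h2
    rw [real_inner_smul_right] at h2
    set Y := h (ε • g) - h 0 with hY
    set s := ⟪v 0, g⟫ with hs
    have hsL : |s| ≤ L * ‖g‖ := (abs_real_inner_le_norm _ _).trans
      (mul_le_mul_of_nonneg_right (hv 0) (norm_nonneg _))
    have hg := norm_nonneg g
    have hY2 : Y ^ 2 ≤ ε ^ 2 * s ^ 2 + ε ^ 3 * (2 * L * B * ‖g‖ ^ 3 + B ^ 2 * ‖g‖ ^ 4) := by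
      have h3 : Y ^ 2 = (ε * s) ^ 2 + 2 * (ε * s) * (Y - ε * s) + (Y - ε * s) ^ 2 := by ring
      have h4 : 2 * (ε * s) * (Y - ε * s) ≤ 2 * (ε * (L * ‖g‖)) * (B * (ε * ‖g‖) ^ 2) := by
        refine (le_abs_self _).trans ?_
        rw [abs_mul, abs_mul, abs_mul, abs_two, abs_of_nonneg hε0]
        gcongr
      have h5 : (Y - ε * s) ^ 2 ≤ (B * (ε * ‖g‖) ^ 2) ^ 2 := by
        rw [← sq_abs]
        exact pow_le_pow_left₀ (abs_nonneg _) h2 2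
      have h6 : ε ^ 4 ≤ ε ^ 3 := pow_le_pow_of_le_one hε0 hε1 (by norm_num)
      have h7 : ε ^ 4 * (B ^ 2 * ‖g‖ ^ 4) ≤ ε ^ 3 * (B ^ 2 * ‖g‖ ^ 4) := by gcongr
      rw [h3]
      linarith
    have hY3 : |Y| ^ 3 * Real.exp |Y| ≤ ε ^ 3 * (6 * L ^ 3 * Real.exp ((L + 1) * ‖g‖)) := by
      have h3 : |Y| ^ 3 ≤ (L * (ε * ‖g‖)) ^ 3 := pow_le_pow_left₀ (abs_nonneg _) h1 3
      have h4 : Real.exp |Y| ≤ Real.exp (L * ‖g‖) := by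
        refine Real.exp_le_exp.2 (h1.trans (mul_le_mul_of_nonneg_left ?_ hL0))
        exact mul_le_of_le_one_left hg hε1
      have h5 : ‖g‖ ^ 3 ≤ 6 * Real.exp ‖g‖ := by
        have := Real.pow_div_factorial_le_exp _ hg 3
        rw [div_le_iff₀' (by positivity)] at this
        simpa [Nat.factorial] using this
      calc |Y| ^ 3 * Real.exp |Y| ≤ (L * (ε * ‖g‖)) ^ 3 * Real.exp (L * ‖g‖) := by gcongr
        _ = ε ^ 3 * L ^ 3 * Real.exp (L * ‖g‖) * ‖g‖ ^ 3 := by ring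
        _ ≤ ε ^ 3 * L ^ 3 * Real.exp (L * ‖g‖) * (6 * Real.exp ‖g‖) := by gcongr
        _ = _ := by rw [add_mul, Real.exp_add, one_mul]; ring
    have h8 := exp_le_quadratic_add Y
    have h9 : Real.exp (h (ε • g)) = Real.exp (h 0) * Real.exp Y := by
      rw [← Real.exp_add, hY]; congr 1; ring
    rw [h9]
    refine mul_le_mul_of_nonneg_left ?_ (Real.exp_pos _).le
    simp only [hΨ]
    linarith
  have hint' : Integrable (fun g => h (ε • g)) (stdGaussian E) := hint
  have hi0 : Integrable (fun g => h (ε • g) - h 0) (stdGaussian E) :=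
    hint'.sub (integrable_const _)
  have hi1 : Integrable (fun g => 1 + (h (ε • g) - h 0)) (stdGaussian E) :=
    (integrable_const _).add hi0
  have hi2 : Integrable (fun g => ε ^ 2 / 2 * ⟪v 0, g⟫ ^ 2 + ε ^ 3 * Ψ g) (stdGaussian E) :=
    (hin2.const_mul _).add (hΨint.const_mul _)
  calc ∫ g, Real.exp (h (ε • g)) ∂(stdGaussian E)
      ≤ ∫ g, Real.exp (h 0) *
        (1 + (h (ε • g) - h 0) + (ε ^ 2 / 2 * ⟪v 0, g⟫ ^ 2 + ε ^ 3 * Ψ g)) ∂(stdGaussian E) :=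
        integral_mono hinte ((hi1.add hi2).const_mul _) hpt
    _ = Real.exp (h 0) * (1 + (∫ g, h (ε • g) ∂(stdGaussian E) - h 0) +
        (ε ^ 2 / 2 * ‖v 0‖ ^ 2 + ε ^ 3 * ∫ g, Ψ g ∂(stdGaussian E))) := by
        rw [integral_const_mul, integral_add hi1 hi2,
          integral_add (integrable_const _) hi0,
          integral_sub hint' (integrable_const _),
          integral_add (hin2.const_mul _) (hΨint.const_mul _), integral_const_mul,
          integral_const_mul, integral_inner_sq_stdGaussian]
        simp
    _ ≤ Real.exp (h 0) * Real.exp ((∫ g, h (ε • g) ∂(stdGaussian E) - h 0) +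
        (ε ^ 2 / 2 * L ^ 2 + ε ^ 3 * ∫ g, Ψ g ∂(stdGaussian E))) := by
        refine mul_le_mul_of_nonneg_left ?_ (Real.exp_pos _).le
        -- Using 1 + z ≤ exp z puts the mean itself into the exponent, where the errors of
        -- successive increments add up.
        refine le_trans ?_ (Real.add_one_le_exp _)
        have : ‖v 0‖ ^ 2 ≤ L ^ 2 := pow_le_pow_left₀ (norm_nonneg _) (hv 0) 2
        have h3 : ε ^ 2 / 2 * ‖v 0‖ ^ 2 ≤ ε ^ 2 / 2 * L ^ 2 := by gcongr
        linarith
    _ = _ := by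
        rw [← Real.exp_add]
        congr 1
        ring

/-- Condition on all increments but the last: `hstep` integrates the last one out at cost c, and the
averaged function is again smooth Lipschitz with the same L and B, so the induction hypothesis
applies to it. -/
lemma integral_exp_scaledGaussian_le {L B c ε : ℝ}
    (hstep : ∀ h : E → ℝ, IsSmoothLipschitz L B h → ∫ z, Real.exp (h z) ∂(scaledGaussian E ε) ≤
      Real.exp (∫ z, h z ∂(scaledGaussian E ε) + c)) (m : ℕ) :
    ∀ h : E → ℝ, IsSmoothLipschitz L B h →
      ∫ z, Real.exp (h z) ∂(scaledGaussian E (√m * ε)) ≤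
        Real.exp (∫ z, h z ∂(scaledGaussian E (√m * ε)) + m * c) := by
  induction m with
  | zero =>
    intro h hh
    simp [scaledGaussian_zero]
  | succ m ih =>
    intro h hh
    have hi := hh.integrable (√(m + 1 : ℕ) * ε)
    have hie := hh.integrable_exp (√(m + 1 : ℕ) * ε)
    rw [← scaledGaussian_conv_sqrt] at hi hie ⊢
    rw [integral_conv hi, integral_conv hie]
    have hH := hh.average ε
    have h1 : ∀ x, ∫ z, Real.exp (h (x + z)) ∂(scaledGaussian E ε) ≤
        Real.exp c * Real.exp (∫ z, h (x + z) ∂(scaledGaussian E ε)) := fun x => by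
      rw [← Real.exp_add, add_comm c]
      exact hstep _ (hh.comp_add x)
    calc _ ≤ ∫ x, Real.exp c * Real.exp (∫ z, h (x + z) ∂(scaledGaussian E ε))
          ∂(scaledGaussian E (√m * ε)) :=
          integral_mono_of_nonneg (ae_of_all _ fun x => integral_nonneg fun z =>
            (Real.exp_pos _).le) ((hH.integrable_exp _).const_mul _) (ae_of_all _ h1)
      _ ≤ Real.exp c * Real.exp (∫ x, (∫ z, h (x + z) ∂(scaledGaussian E ε))
          ∂(scaledGaussian E (√m * ε)) + m * c) := by
          rw [integral_const_mul]
          exact mul_le_mul_of_nonneg_left (ih _ hH) (Real.exp_pos _).le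
      _ = _ := by
          rw [← Real.exp_add]
          congr 1
          push_cast
          ring

/-- The sharp Gaussian bound on the exponential moments of a smooth Lipschitz function. -/
lemma IsSmoothLipschitz.integral_exp_le {L B : ℝ} {h : E → ℝ} (hh : IsSmoothLipschitz L B h)
    (hB0 : 0 ≤ B) :
    ∫ x, Real.exp (h x) ∂(stdGaussian E) ≤
      Real.exp (∫ x, h x ∂(stdGaussian E) + L ^ 2 / 2) := by
  obtain ⟨K, hK, hstep⟩ := exists_integral_exp_le (E := E) hh.nonneg hB0
  have hm : ∀ m : ℕ, ∫ x, Real.exp (h x) ∂(stdGaussian E) ≤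
      Real.exp (∫ x, h x ∂(stdGaussian E) + (L ^ 2 / 2 + K / √(m + 1 : ℕ))) := by
    intro m
    have hpos : 0 < √((m + 1 : ℕ) : ℝ) := Real.sqrt_pos.2 (by positivity)
    have h1 : (1 : ℝ) ≤ √((m + 1 : ℕ) : ℝ) := Real.one_le_sqrt.2 (by simp)
    -- With m + 1 increments of size ε = 1/√(m+1), the costs ε²L²/2 sum to exactly L²/2 and the
    -- costs ε³K to K/√(m+1).
    have h2 := integral_exp_scaledGaussian_le (fun f hf => hstep f hf (√((m + 1 : ℕ) : ℝ))⁻¹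
      (by positivity) (inv_le_one_of_one_le₀ h1)) (m + 1) h hh
    rw [mul_inv_cancel₀ hpos.ne', scaledGaussian_one] at h2
    refine h2.trans_eq ?_
    congr 2
    have h3 : ((m + 1 : ℕ) : ℝ) = √((m + 1 : ℕ) : ℝ) ^ 2 := (Real.sq_sqrt (by positivity)).symm
    generalize √((m + 1 : ℕ) : ℝ) = r at *
    rw [h3]
    field_simp
  have hlim : Tendsto (fun m : ℕ => Real.exp (∫ x, h x ∂(stdGaussian E) +
      (L ^ 2 / 2 + K / √(m + 1 : ℕ)))) atTop
      (nhds (Real.exp (∫ x, h x ∂(stdGaussian E) + (L ^ 2 / 2 + 0)))) := by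
    refine (Real.continuous_exp.tendsto _).comp (tendsto_const_nhds.add
      (tendsto_const_nhds.add (tendsto_const_nhds.div_atTop ?_)))
    exact Real.tendsto_sqrt_atTop.comp (tendsto_natCast_atTop_atTop.comp (tendsto_add_atTop_nat 1))
  rw [add_zero] at hlim
  exact ge_of_tendsto' hlim hm

end Concentration

/-! ### Sudakov-Fernique comparison for log-sum-exp, by Lindeberg replacement. -/

section Comparison

open scoped RealInnerProductSpace

variable {V : Type*} [NormedAddCommGroup V] [MeasurableSpace V] [BorelSpace V]
  [SecondCountableTopology V]

lemma integrable_norm_conv {μ ν : Measure V} [IsProbabilityMeasure μ] [IsProbabilityMeasure ν]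
    (hμ : Integrable (fun x => ‖x‖) μ) (hν : Integrable (fun x => ‖x‖) ν) :
    Integrable (fun x => ‖x‖) (μ ∗ ν) := by
  rw [Measure.conv, integrable_map_measure (by fun_prop) (by fun_prop)]
  exact ((hμ.comp_fst ν).add (hν.comp_snd μ)).mono' (by fun_prop)
    (ae_of_all _ fun p => by simpa using norm_add_le p.1 p.2)

/-- The Lindeberg replacement argument for two convolution semigroups. -/
lemma integral_conv_le_of_step {f : V → ℝ} {a b δ : ℝ} (hf : Continuous f)
    (hfb : ∀ w, |f w| ≤ a + b * ‖w‖) {μ ν : ℕ → Measure V} [∀ j, IsProbabilityMeasure (μ j)]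
    [∀ j, IsProbabilityMeasure (ν j)] {μ₁ ν₁ : Measure V} [IsProbabilityMeasure μ₁]
    [IsProbabilityMeasure ν₁] (hμ : ∀ j, Integrable (fun x => ‖x‖) (μ j))
    (hμ₁ : Integrable (fun x => ‖x‖) μ₁)
    (hν₁ : Integrable (fun x => ‖x‖) ν₁)
    (h0 : μ 0 = ν 0) (hμs : ∀ j, μ j ∗ μ₁ = μ (j + 1)) (hνs : ∀ j, ν j ∗ ν₁ = ν (j + 1))
    (hstep : ∀ w, ∫ y, f (w + y) ∂μ₁ ≤ ∫ y, f (w + y) ∂ν₁ + δ) (j : ℕ) :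
    ∀ (ρ : Measure V) [IsProbabilityMeasure ρ], Integrable (fun x => ‖x‖) ρ →
      ∫ x, f x ∂(ρ ∗ μ j) ≤ ∫ x, f x ∂(ρ ∗ ν j) + j * δ := by
  have hfi : ∀ (ρ : Measure V) [IsProbabilityMeasure ρ], Integrable (fun x => ‖x‖) ρ →
      Integrable f ρ := fun ρ _ hρ =>
    ((integrable_const a).add (hρ.const_mul b)).mono' hf.aestronglyMeasurable (ae_of_all _ hfb)
  induction j with
  | zero =>
    intro ρ _ hρ
    simp [h0]
  | succ j ih =>
    intro ρ _ hρ
    have h1 := integrable_norm_conv hρ (hμ j)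
    have hi1 := hfi _ (integrable_norm_conv h1 hμ₁)
    have hi2 := hfi _ (integrable_norm_conv h1 hν₁)
    have h2 : ∫ x, f x ∂((ρ ∗ μ j) ∗ μ₁) ≤ ∫ x, f x ∂((ρ ∗ μ j) ∗ ν₁) + δ := by
      rw [integral_conv hi1, integral_conv hi2]
      have hj1 : Integrable (fun x => ∫ y, f (x + y) ∂μ₁) (ρ ∗ μ j) :=
        ((integrable_map_measure hf.aestronglyMeasurable (by fun_prop)).1 hi1).integral_prod_left
      have hj2 : Integrable (fun x => ∫ y, f (x + y) ∂ν₁) (ρ ∗ μ j) :=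
        ((integrable_map_measure hf.aestronglyMeasurable (by fun_prop)).1 hi2).integral_prod_left
      calc _ ≤ ∫ x, (∫ y, f (x + y) ∂ν₁ + δ) ∂(ρ ∗ μ j) :=
            integral_mono hj1 (hj2.add (integrable_const _)) hstep
        _ = _ := by rw [integral_add hj2 (integrable_const _)]; simp
    -- The increment already replaced is absorbed into ρ, which is why the induction quantifies over
    -- ρ. Commutativity of convolution does the reordering.
    have h3 := ih (ρ ∗ ν₁) (integrable_norm_conv hρ hν₁)
    have e1 : (ρ ∗ μ j) ∗ ν₁ = (ρ ∗ ν₁) ∗ μ j := by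
      rw [Measure.conv_assoc, Measure.conv_comm (μ j), Measure.conv_assoc]
    have e2 : (ρ ∗ ν₁) ∗ ν j = ρ ∗ ν (j + 1) := by
      rw [Measure.conv_assoc, Measure.conv_comm ν₁, hνs]
    rw [e1] at h2
    rw [e2] at h3
    rw [← hμs, ← Measure.conv_assoc]
    push_cast
    linarith

variable {A : Type*} {E : Type*} [NormedAddCommGroup E] [InnerProductSpace ℝ E]

/-- The linear map whose coordinates are the inner products with the vectors `t a`. -/
noncomputable def innerPi (t : A → E) : E →L[ℝ] (A → ℝ) :=
  ContinuousLinearMap.pi fun a => innerSL ℝ (t a)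

@[simp]
lemma innerPi_apply (t : A → E) (x : E) (a : A) : innerPi t x a = ⟪t a, x⟫ := rfl

lemma abs_innerPi_le {t : A → E} {L : ℝ} (ht : ∀ a, ‖t a‖ ≤ L) (x : E) (a : A) :
    |innerPi t x a| ≤ L * ‖x‖ :=
  (abs_real_inner_le_norm _ _).trans (mul_le_mul_of_nonneg_right (ht a) (norm_nonneg x))

variable [Fintype A] [Nonempty A]

lemma abs_logSumExp_le (w : A → ℝ) : |logSumExp w| ≤ |logSumExp (0 : A → ℝ)| + 1 * ‖w‖ := by
  have h := abs_logSumExp_add_sub_le (w := 0) (y := w) (R := ‖w‖) fun a => norm_le_pi_norm w a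
  rw [zero_add] at h
  have := abs_sub_abs_le_abs_sub (logSumExp w) (logSumExp (0 : A → ℝ))
  linarith

/-- The gradient is a softmax-weighted convex combination of the vectors t a, so its norm is at most
L however large A is. -/
lemma isSmoothLipschitz_logSumExp {t : A → E} {L : ℝ} (ht : ∀ a, ‖t a‖ ≤ L) :
    IsSmoothLipschitz L (11 * L ^ 2) fun x => logSumExp (innerPi t x) := by
  refine ⟨fun x => ∑ a, softmax (innerPi t x) a • t a, by fun_prop, fun x => ?_, fun x y => ?_,
    fun x y => ?_⟩
  · calc _ ≤ ∑ a, softmax (innerPi t x) a * L := by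
          refine (norm_sum_le _ _).trans (Finset.sum_le_sum fun a _ => ?_)
          rw [norm_smul, Real.norm_of_nonneg (softmax_nonneg _ a)]
          exact mul_le_mul_of_nonneg_left (ht a) (softmax_nonneg _ a)
      _ = L := by rw [← Finset.sum_mul, sum_softmax, one_mul]
  · simp only [map_add]
    exact abs_logSumExp_add_sub_le fun a => abs_innerPi_le ht y a
  · have h := abs_logSumExp_add_sub_sub_le_sq (w := innerPi t x)
      fun a => abs_innerPi_le ht y a
    simp only [map_add, sum_inner, real_inner_smul_left]
    rw [mul_pow, ← mul_assoc] at h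
    exact h

variable [FiniteDimensional ℝ E] [MeasurableSpace E] [BorelSpace E]

/-- Second order expansion of `log ∑ exp` under a small Gaussian increment. -/
lemma exists_abs_integral_logSumExp_add_sub_le (t : A → E) :
    ∃ K : ℝ, 0 ≤ K ∧ ∀ ε : ℝ, 0 ≤ ε → ∀ w : A → ℝ,
      |∫ y, logSumExp (w + y) ∂((scaledGaussian E ε).map (innerPi t)) - logSumExp w -
        ε ^ 2 / 4 * ∑ a, ∑ b, softmax w a * softmax w b * ‖t a - t b‖ ^ 2| ≤ K * ε ^ 3 := by
  set L := ∑ a, ‖t a‖ with hL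
  have ht : ∀ a, ‖t a‖ ≤ L := fun a =>
    Finset.single_le_sum (f := fun a => ‖t a‖) (fun _ _ => norm_nonneg _) (Finset.mem_univ a)
  have hL0 : 0 ≤ L := Finset.sum_nonneg fun _ _ => norm_nonneg _
  have hpow : ∀ j, Integrable (fun x : E => ‖x‖ ^ j) (stdGaussian E) := fun j => by
    rw [← scaledGaussian_one]; exact integrable_pow_norm_scaledGaussian 1 j
  refine ⟨10 * L ^ 3 * ∫ x, ‖x‖ ^ 3 ∂(stdGaussian E), by positivity, fun ε hε w => ?_⟩
  have hw : Continuous fun y : A → ℝ => logSumExp (w + y) := by fun_prop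
  rw [integral_map (by fun_prop) hw.aestronglyMeasurable,
    integral_scaledGaussian ε (by fun_prop)]
  have hi1 : Integrable (fun x => logSumExp (w + innerPi t (ε • x))) (stdGaussian E) := by
    rw [← scaledGaussian_one]
    refine integrable_of_abs_le_norm (a := |logSumExp w|) (b := ε * L) (by fun_prop) fun x => ?_
    have h1 := abs_logSumExp_add_sub_le (w := w) fun a => abs_innerPi_le ht (ε • x) a
    have h2 := abs_sub_abs_le_abs_sub (logSumExp (w + innerPi t (ε • x))) (logSumExp w)
    rw [norm_smul, Real.norm_of_nonneg hε] at h1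
    linarith
  have hin : ∀ s : E, Integrable (fun x => ⟪s, x⟫) (stdGaussian E) := fun s => by
    rw [← scaledGaussian_one]
    refine integrable_of_abs_le_norm (a := 0) (b := ‖s‖) (by fun_prop) fun x => ?_
    rw [zero_add]
    exact abs_real_inner_le_norm _ _
  have hin2 : ∀ s : E, Integrable (fun x => ⟪s, x⟫ ^ 2) (stdGaussian E) := fun s => by
    refine ((hpow 2).const_mul (‖s‖ ^ 2)).mono' (Continuous.aestronglyMeasurable (by fun_prop))
      (ae_of_all _ fun x => ?_)
    rw [Real.norm_of_nonneg (sq_nonneg _), ← mul_pow, ← sq_abs ⟪s, x⟫]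
    exact pow_le_pow_left₀ (abs_nonneg _) (abs_real_inner_le_norm _ _) 2
  have hi2 : Integrable (fun x => ∑ a, softmax w a * (ε * ⟪t a, x⟫)) (stdGaussian E) :=
    integrable_finsetSum _ fun a _ => ((hin _).const_mul _).const_mul _
  have hi3 : Integrable (fun x => ∑ a, ∑ b, softmax w a * softmax w b *
      (ε ^ 2 * ⟪t a - t b, x⟫ ^ 2)) (stdGaussian E) :=
    integrable_finsetSum _ fun a _ => integrable_finsetSum _ fun b _ =>
      ((hin2 _).const_mul _).const_mul _
  have hpt : ∀ x, |logSumExp (w + innerPi t (ε • x)) - logSumExp w -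
      ∑ a, softmax w a * (ε * ⟪t a, x⟫) - (∑ a, ∑ b, softmax w a * softmax w b *
      (ε ^ 2 * ⟪t a - t b, x⟫ ^ 2)) / 4| ≤ 10 * (ε * L) ^ 3 * ‖x‖ ^ 3 := by
    intro x
    have h := abs_logSumExp_add_sub_sub_le (w := w) fun a => abs_innerPi_le ht (ε • x) a
    rw [norm_smul, Real.norm_of_nonneg hε] at h
    simp only [innerPi_apply, real_inner_smul_right, ← mul_sub, ← inner_sub_left, mul_pow] at h
    simp only [mul_pow]
    refine h.trans_eq (by ring)
  have hc : Integrable (fun _ : E => logSumExp w) (stdGaussian E) := integrable_const _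
  have e : ∫ x, (logSumExp (w + innerPi t (ε • x)) - logSumExp w -
      ∑ a, softmax w a * (ε * ⟪t a, x⟫) - (∑ a, ∑ b, softmax w a * softmax w b *
      (ε ^ 2 * ⟪t a - t b, x⟫ ^ 2)) / 4) ∂(stdGaussian E) =
      ∫ x, logSumExp (w + innerPi t (ε • x)) ∂(stdGaussian E) - logSumExp w -
        ε ^ 2 / 4 * ∑ a, ∑ b, softmax w a * softmax w b * ‖t a - t b‖ ^ 2 := by
    have hi4 : Integrable (fun x => logSumExp (w + innerPi t (ε • x)) - logSumExp w)
      (stdGaussian E) := hi1.sub hc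
    have hi5 : Integrable (fun x => logSumExp (w + innerPi t (ε • x)) - logSumExp w -
      ∑ a, softmax w a * (ε * ⟪t a, x⟫)) (stdGaussian E) := hi4.sub hi2
    rw [integral_sub hi5 (hi3.div_const 4), integral_sub hi4 hi2, integral_sub hi1 hc,
      integral_div, integral_finsetSum _ fun a _ => ((hin _).const_mul _).const_mul _,
      integral_finsetSum _ fun a _ => integrable_finsetSum _ fun b _ =>
        ((hin2 _).const_mul _).const_mul _]
    have h1 : ∀ a, ∫ x, ∑ b, softmax w a * softmax w b * (ε ^ 2 * ⟪t a - t b, x⟫ ^ 2)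
        ∂(stdGaussian E) = ε ^ 2 * ∑ b, softmax w a * softmax w b * ‖t a - t b‖ ^ 2 := by
      intro a
      rw [integral_finsetSum _ fun b _ => ((hin2 _).const_mul _).const_mul _, Finset.mul_sum]
      refine Finset.sum_congr rfl fun b _ => ?_
      rw [integral_const_mul, integral_const_mul, integral_inner_sq_stdGaussian]
      ring
    -- The linear term has mean zero, and each squared form ⟪t a - t b, x⟫² has mean ‖t a - t b‖².
    simp only [h1, integral_const_mul, integral_inner_stdGaussian, ← Finset.mul_sum]
    simp
    ring
  rw [← e, ← Real.norm_eq_abs]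
  refine (norm_integral_le_of_norm_le ((hpow 3).const_mul _) (ae_of_all _ hpt)).trans_eq ?_
  rw [integral_const_mul]
  ring

variable {E' : Type*} [NormedAddCommGroup E'] [InnerProductSpace ℝ E'] [FiniteDimensional ℝ E']
  [MeasurableSpace E'] [BorelSpace E']

lemma map_innerPi_conv (t : A → E) (m : ℕ) (c : ℝ) :
    (scaledGaussian E (√m * c)).map (innerPi t) ∗ (scaledGaussian E c).map (innerPi t) =
      (scaledGaussian E (√(m + 1 : ℕ) * c)).map (innerPi t) := by
  rw [← scaledGaussian_conv_sqrt, Measure.map_conv_continuousLinearMap]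

lemma integrable_norm_map_innerPi (t : A → E) (c : ℝ) :
    Integrable (fun x => ‖x‖) ((scaledGaussian E c).map (innerPi t)) := by
  rw [integrable_map_measure (by fun_prop) (by fun_prop)]
  refine integrable_of_abs_le_norm (a := 0) (b := ‖innerPi t‖) (by fun_prop) fun x => ?_
  simpa using (innerPi t).le_opNorm x

/-- The Sudakov-Fernique comparison for `log ∑ exp` of finite Gaussian families. -/
lemma integral_logSumExp_le_of_norm_sub_le {t : A → E} {s : A → E'}
    (hts : ∀ a b, ‖t a - t b‖ ≤ ‖s a - s b‖) :
    ∫ x, logSumExp (innerPi t x) ∂(stdGaussian E) ≤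
      ∫ y, logSumExp (innerPi s y) ∂(stdGaussian E') := by
  obtain ⟨K, hK, hKt⟩ := exists_abs_integral_logSumExp_add_sub_le t
  obtain ⟨K', hK', hKs⟩ := exists_abs_integral_logSumExp_add_sub_le s
  have hm : ∀ m : ℕ, ∫ x, logSumExp (innerPi t x) ∂(stdGaussian E) ≤
      ∫ y, logSumExp (innerPi s y) ∂(stdGaussian E') + (K + K') / √(m + 1 : ℕ) := by
    intro m
    have hpos : 0 < √((m + 1 : ℕ) : ℝ) := Real.sqrt_pos.2 (by positivity)
    -- Each of the m + 1 replacements costs at most (K + K')ε³, in total (K + K')/√(m+1). The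
    -- second-order terms are ordered by `hts` because the softmax weights are nonnegative.
    set ε : ℝ := (√((m + 1 : ℕ) : ℝ))⁻¹ with hε
    have hε0 : 0 ≤ ε := by positivity
    have hprob : ∀ c, IsProbabilityMeasure ((scaledGaussian E c).map (innerPi t)) := fun c =>
      Measure.isProbabilityMeasure_map (by fun_prop)
    have hprob' : ∀ c, IsProbabilityMeasure ((scaledGaussian E' c).map (innerPi s)) := fun c =>
      Measure.isProbabilityMeasure_map (by fun_prop)
    have hstep : ∀ w : A → ℝ,
        ∫ y, logSumExp (w + y) ∂((scaledGaussian E ε).map (innerPi t)) ≤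
        ∫ y, logSumExp (w + y) ∂((scaledGaussian E' ε).map (innerPi s)) + (K + K') * ε ^ 3 := by
      intro w
      have h1 := (abs_le.1 (hKt ε hε0 w)).2
      have h2 := (abs_le.1 (hKs ε hε0 w)).1
      have h3 : ε ^ 2 / 4 * ∑ a, ∑ b, softmax w a * softmax w b * ‖t a - t b‖ ^ 2 ≤
          ε ^ 2 / 4 * ∑ a, ∑ b, softmax w a * softmax w b * ‖s a - s b‖ ^ 2 := by
        refine mul_le_mul_of_nonneg_left (Finset.sum_le_sum fun a _ => Finset.sum_le_sum
          fun b _ => mul_le_mul_of_nonneg_left (pow_le_pow_left₀ (norm_nonneg _) (hts a b) 2)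
            (mul_nonneg (softmax_nonneg _ _) (softmax_nonneg _ _))) (by positivity)
      linarith
    have h := integral_conv_le_of_step (f := logSumExp) (by fun_prop) abs_logSumExp_le
      (μ := fun j : ℕ => (scaledGaussian E (√j * ε)).map (innerPi t))
      (ν := fun j : ℕ => (scaledGaussian E' (√j * ε)).map (innerPi s))
      (fun j => integrable_norm_map_innerPi t _)
      (integrable_norm_map_innerPi t ε) (integrable_norm_map_innerPi s ε)
      (by simp [scaledGaussian_zero]) (fun j => map_innerPi_conv t j ε)
      (fun j => map_innerPi_conv s j ε) hstep (m + 1) (Measure.dirac 0)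
      (integrable_dirac (by simp))
    have hone : √((m + 1 : ℕ) : ℝ) * ε = 1 := mul_inv_cancel₀ hpos.ne'
    simp only [Measure.dirac_zero_conv, hone, scaledGaussian_one] at h
    rw [integral_map (by fun_prop) continuous_logSumExp.aestronglyMeasurable,
      integral_map (by fun_prop) continuous_logSumExp.aestronglyMeasurable] at h
    refine h.trans_eq ?_
    congr 1
    have h3 : ((m + 1 : ℕ) : ℝ) = √((m + 1 : ℕ) : ℝ) ^ 2 := (Real.sq_sqrt (by positivity)).symm
    rw [hε]
    generalize √((m + 1 : ℕ) : ℝ) = r at *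
    rw [h3]
    field_simp
  have hlim : Tendsto (fun m : ℕ => ∫ y, logSumExp (innerPi s y) ∂(stdGaussian E') +
      (K + K') / √(m + 1 : ℕ)) atTop
      (nhds (∫ y, logSumExp (innerPi s y) ∂(stdGaussian E') + 0)) := by
    refine tendsto_const_nhds.add (tendsto_const_nhds.div_atTop ?_)
    exact Real.tendsto_sqrt_atTop.comp (tendsto_natCast_atTop_atTop.comp (tendsto_add_atTop_nat 1))
  rw [add_zero] at hlim
  exact ge_of_tendsto' hlim hm

end Comparison

/-! ### Passage from log-sum-exp to suprema of countable families. -/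

section Supremum

open scoped RealInnerProductSpace

variable {E : Type*} [NormedAddCommGroup E] [InnerProductSpace ℝ E]

/-- A smooth approximation from above of the maximum of the linear forms `⟪t j, ·⟫`, `j ≤ N`. -/
noncomputable def softMaxInner (t : ℕ → E) (N : ℕ) (x : E) : ℝ :=
  ((N : ℝ) + 1)⁻¹ * logSumExp (innerPi (fun j : Fin (N + 1) => ((N : ℝ) + 1) • t j) x)

lemma inner_le_softMaxInner (t : ℕ → E) {N j : ℕ} (hj : j ≤ N) (x : E) :
    ⟪t j, x⟫ ≤ softMaxInner t N x := by
  have h := le_logSumExp (innerPi (fun j : Fin (N + 1) => ((N : ℝ) + 1) • t j) x)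
    ⟨j, Nat.lt_succ_of_le hj⟩
  rw [innerPi_apply, real_inner_smul_left] at h
  rw [softMaxInner, le_inv_mul_iff₀ (by positivity)]
  exact h

lemma softMaxInner_le {t : ℕ → E} {x : E} {c : ℝ} (h : ∀ j, ⟪t j, x⟫ ≤ c) (N : ℕ) :
    softMaxInner t N x ≤ c + Real.log (N + 1) / (N + 1) := by
  have h1 := logSumExp_le (w := innerPi (fun j : Fin (N + 1) => ((N : ℝ) + 1) • t j) x)
    (c := (N + 1) * c) fun a => by
      rw [innerPi_apply, real_inner_smul_left]
      exact mul_le_mul_of_nonneg_left (h a) (by positivity)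
  rw [softMaxInner, inv_mul_le_iff₀ (by positivity), mul_add, mul_div_cancel₀ _ (by positivity)]
  simpa using h1

lemma isSmoothLipschitz_softMaxInner {t : ℕ → E} {L : ℝ} (ht : ∀ j, ‖t j‖ ≤ L) (N : ℕ) :
    ∃ B, 0 ≤ B ∧ IsSmoothLipschitz L B (softMaxInner t N) := by
  have hN : (0 : ℝ) < N + 1 := by positivity
  have h := (isSmoothLipschitz_logSumExp (t := fun j : Fin (N + 1) => ((N : ℝ) + 1) • t j)
    (L := (N + 1) * L) fun a => by
      rw [norm_smul, Real.norm_of_nonneg hN.le]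
      exact mul_le_mul_of_nonneg_left (ht a) hN.le).const_mul ((N : ℝ) + 1)⁻¹
  rw [abs_of_pos (inv_pos.2 hN), inv_mul_cancel_left₀ hN.ne'] at h
  exact ⟨_, by positivity, h⟩

lemma log_div_le_one (N : ℕ) : Real.log ((N : ℝ) + 1) / (N + 1) ≤ 1 := by
  rw [div_le_one (by positivity)]
  have := Real.log_le_sub_one_of_pos (x := (N : ℝ) + 1) (by positivity)
  linarith

lemma tendsto_log_div : Tendsto (fun N : ℕ => Real.log ((N : ℝ) + 1) / (N + 1)) atTop (nhds 0) := by
  have h := Real.isLittleO_log_id_atTop.tendsto_div_nhds_zero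
  exact h.comp (tendsto_atTop_add_const_right _ 1 tendsto_natCast_atTop_atTop)

lemma abs_softMaxInner_le {t : ℕ → E} {L : ℝ} (ht : ∀ j, ‖t j‖ ≤ L) (N : ℕ) (x : E) :
    |softMaxInner t N x| ≤ L * ‖x‖ + 1 := by
  have h : ∀ j, |⟪t j, x⟫| ≤ L * ‖x‖ := fun j =>
    (abs_real_inner_le_norm _ _).trans (mul_le_mul_of_nonneg_right (ht j) (norm_nonneg x))
  have h1 := softMaxInner_le (fun j => (abs_le.1 (h j)).2) N
  have h2 := inner_le_softMaxInner t (Nat.zero_le N) x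
  have h3 := (abs_le.1 (h 0)).1
  have h4 := log_div_le_one N
  exact abs_le.2 ⟨by linarith, by linarith⟩

/-- N + 1 is both the number of forms and the inverse temperature, so the entropy error is
log(N+1)/(N+1) and a single limit removes truncation and smoothing together. -/
lemma tendsto_softMaxInner {t : ℕ → E} {x : E} {M : ℝ}
    (hM : IsLUB (Set.range fun j => ⟪t j, x⟫) M) :
    Tendsto (fun N => softMaxInner t N x) atTop (nhds M) := by
  have hup : Tendsto (fun N : ℕ => M + Real.log ((N : ℝ) + 1) / (N + 1)) atTop (nhds M) := by
    simpa using tendsto_const_nhds.add tendsto_log_div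
  refine tendsto_order.2 ⟨fun a ha => ?_, fun a ha => ?_⟩
  · obtain ⟨_, ⟨j, rfl⟩, hj, -⟩ := hM.exists_between ha
    filter_upwards [eventually_ge_atTop j] with N hN
    exact hj.trans_le (inner_le_softMaxInner t hN x)
  · filter_upwards [hup.eventually_lt_const ha] with N hN
    exact (softMaxInner_le (fun j => hM.1 ⟨j, rfl⟩) N).trans_lt hN

variable [FiniteDimensional ℝ E] [MeasurableSpace E] [BorelSpace E]

lemma integrable_exp_mul_softMaxInner_bound (L a : ℝ) :
    Integrable (fun x : E => Real.exp (|a| * (L * ‖x‖ + 1))) (stdGaussian E) := by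
  refine ((integrable_exp_mul_norm_stdGaussian (E := E) (|a| * L)).const_mul
    (Real.exp |a|)).congr (ae_of_all _ fun x => ?_)
  simp only [← Real.exp_add]
  congr 1
  ring

lemma integrable_mul_norm_add_one (L : ℝ) :
    Integrable (fun x : E => L * ‖x‖ + 1) (stdGaussian E) :=
  (IsGaussian.integrable_id.norm.const_mul L).add (integrable_const 1)

variable {t : ℕ → E} {F : E → ℝ} {L : ℝ}

lemma continuous_softMaxInner (ht : ∀ j, ‖t j‖ ≤ L) (N : ℕ) : Continuous (softMaxInner t N) := by
  obtain ⟨B, -, h⟩ := isSmoothLipschitz_softMaxInner ht N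
  exact h.continuous

lemma aestronglyMeasurable_of_isLUB (ht : ∀ j, ‖t j‖ ≤ L)
    (hF : ∀ x, IsLUB (Set.range fun j => ⟪t j, x⟫) (F x)) :
    AEStronglyMeasurable F (stdGaussian E) :=
  aestronglyMeasurable_of_tendsto_ae atTop
    (fun N => (continuous_softMaxInner ht N).aestronglyMeasurable)
    (ae_of_all _ fun x => tendsto_softMaxInner (hF x))

lemma abs_le_of_isLUB (ht : ∀ j, ‖t j‖ ≤ L)
    (hF : ∀ x, IsLUB (Set.range fun j => ⟪t j, x⟫) (F x)) (x : E) : |F x| ≤ L * ‖x‖ + 1 :=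
  le_of_tendsto' (tendsto_softMaxInner (hF x)).abs fun N => abs_softMaxInner_le ht N x

lemma integrable_of_isLUB (ht : ∀ j, ‖t j‖ ≤ L)
    (hF : ∀ x, IsLUB (Set.range fun j => ⟪t j, x⟫) (F x)) : Integrable F (stdGaussian E) :=
  (integrable_mul_norm_add_one L).mono' (aestronglyMeasurable_of_isLUB ht hF)
    (ae_of_all _ (abs_le_of_isLUB ht hF))

lemma tendsto_integral_softMaxInner (ht : ∀ j, ‖t j‖ ≤ L)
    (hF : ∀ x, IsLUB (Set.range fun j => ⟪t j, x⟫) (F x)) :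
    Tendsto (fun N => ∫ x, softMaxInner t N x ∂(stdGaussian E)) atTop
      (nhds (∫ x, F x ∂(stdGaussian E))) :=
  tendsto_integral_of_dominated_convergence (fun x => L * ‖x‖ + 1)
    (fun N => (continuous_softMaxInner ht N).aestronglyMeasurable)
    (integrable_mul_norm_add_one L)
    (fun N => ae_of_all _ (abs_softMaxInner_le ht N))
    (ae_of_all _ fun x => tendsto_softMaxInner (hF x))

/-- Sharp sub-Gaussian concentration of the supremum of a bounded family of Gaussian linear forms. -/
lemma hasSubgaussianMGF_of_isLUB (ht : ∀ j, ‖t j‖ ≤ L)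
    (hF : ∀ x, IsLUB (Set.range fun j => ⟪t j, x⟫) (F x)) :
    HasSubgaussianMGF (fun x => F x - ∫ y, F y ∂(stdGaussian E)) (L ^ 2).toNNReal
      (stdGaussian E) := by
  have hFm := aestronglyMeasurable_of_isLUB ht hF
  have hexp : ∀ a : ℝ, Integrable (fun x => Real.exp (a * F x)) (stdGaussian E) := by
    intro a
    refine (integrable_exp_mul_softMaxInner_bound L a).mono'
      (Real.continuous_exp.comp_aestronglyMeasurable (hFm.const_mul a)) (ae_of_all _ fun x => ?_)
    rw [Real.norm_of_nonneg (Real.exp_pos _).le, Real.exp_le_exp]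
    refine (le_abs_self _).trans ?_
    rw [abs_mul]
    exact mul_le_mul_of_nonneg_left (abs_le_of_isLUB ht hF x) (abs_nonneg a)
  have hmgf : ∀ a : ℝ, ∫ x, Real.exp (a * F x) ∂(stdGaussian E) ≤
      Real.exp (a * ∫ x, F x ∂(stdGaussian E) + (a * L) ^ 2 / 2) := by
    intro a
    have h1 : Tendsto (fun N => ∫ x, Real.exp (a * softMaxInner t N x) ∂(stdGaussian E)) atTop
        (nhds (∫ x, Real.exp (a * F x) ∂(stdGaussian E))) := by
      refine tendsto_integral_of_dominated_convergence _
        (fun N => ?_) (integrable_exp_mul_softMaxInner_bound L a)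
        (fun N => ae_of_all _ fun x => ?_)
        (ae_of_all _ fun x => (Real.continuous_exp.tendsto _).comp
          ((tendsto_softMaxInner (hF x)).const_mul a))
      · have := continuous_softMaxInner ht N
        exact Continuous.aestronglyMeasurable (by fun_prop)
      · rw [Real.norm_of_nonneg (Real.exp_pos _).le, Real.exp_le_exp]
        refine (le_abs_self _).trans ?_
        rw [abs_mul]
        exact mul_le_mul_of_nonneg_left (abs_softMaxInner_le ht N x) (abs_nonneg a)
    have h2 : Tendsto (fun N => Real.exp (a * ∫ x, softMaxInner t N x ∂(stdGaussian E) +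
        (a * L) ^ 2 / 2)) atTop (nhds (Real.exp (a * ∫ x, F x ∂(stdGaussian E) +
        (a * L) ^ 2 / 2))) :=
      (Real.continuous_exp.tendsto _).comp
        (((tendsto_integral_softMaxInner ht hF).const_mul a).add tendsto_const_nhds)
    refine le_of_tendsto_of_tendsto' h1 h2 fun N => ?_
    -- B may depend on N, but the exponential moment bound involves only L, so it survives the
    -- limit.
    obtain ⟨B, hB, h⟩ := isSmoothLipschitz_softMaxInner ht N
    have h3 := (h.const_mul a).integral_exp_le (by positivity)
    rwa [integral_const_mul, mul_pow, sq_abs, ← mul_pow] at h3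
  have heq : ∀ a : ℝ, (fun x => Real.exp (a * (F x - ∫ y, F y ∂(stdGaussian E)))) =
      fun x => Real.exp (a * F x) * Real.exp (-(a * ∫ y, F y ∂(stdGaussian E))) := by
    intro a
    ext x
    rw [← Real.exp_add]
    congr 1
    ring
  refine ⟨fun a => ?_, fun a => ?_⟩
  · rw [heq]
    exact (hexp a).mul_const _
  · rw [mgf, heq, integral_mul_const]
    calc _ ≤ Real.exp (a * ∫ x, F x ∂(stdGaussian E) + (a * L) ^ 2 / 2) *
          Real.exp (-(a * ∫ y, F y ∂(stdGaussian E))) :=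
          mul_le_mul_of_nonneg_right (hmgf a) (Real.exp_pos _).le
      _ = _ := by
          rw [← Real.exp_add, Real.coe_toNNReal _ (sq_nonneg L)]
          congr 1
          ring

variable {E' : Type*} [NormedAddCommGroup E'] [InnerProductSpace ℝ E'] [FiniteDimensional ℝ E']
  [MeasurableSpace E'] [BorelSpace E']

/-- The Sudakov-Fernique comparison for suprema of Gaussian linear forms. -/
lemma integral_le_of_norm_sub_le (ht : ∀ j, ‖t j‖ ≤ L)
    (hF : ∀ x, IsLUB (Set.range fun j => ⟪t j, x⟫) (F x)) {s : ℕ → E'} {L' : ℝ}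
    (hs : ∀ j, ‖s j‖ ≤ L') (hts : ∀ i j, ‖t i - t j‖ ≤ ‖s i - s j‖) {H : E' → ℝ}
    (hH : Integrable H (stdGaussian E')) (hsH : ∀ j y, ⟪s j, y⟫ ≤ H y) :
    ∫ x, F x ∂(stdGaussian E) ≤ ∫ y, H y ∂(stdGaussian E') := by
  have hlim : Tendsto (fun N : ℕ => ∫ y, H y ∂(stdGaussian E') +
      Real.log ((N : ℝ) + 1) / (N + 1)) atTop (nhds (∫ y, H y ∂(stdGaussian E') + 0)) :=
    tendsto_const_nhds.add tendsto_log_div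
  rw [add_zero] at hlim
  refine le_of_tendsto_of_tendsto' (tendsto_integral_softMaxInner ht hF) hlim fun N => ?_
  have h1 : ∫ x, softMaxInner t N x ∂(stdGaussian E) ≤
      ∫ y, softMaxInner s N y ∂(stdGaussian E') := by
    simp only [softMaxInner, integral_const_mul]
    refine mul_le_mul_of_nonneg_left (integral_logSumExp_le_of_norm_sub_le fun a b => ?_)
      (by positivity)
    rw [← smul_sub, ← smul_sub, norm_smul, norm_smul]
    exact mul_le_mul_of_nonneg_left (hts a b) (norm_nonneg _)
  -- On the larger side only domination by H matters; H need not be the supremum.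
  have h2 : ∫ y, softMaxInner s N y ∂(stdGaussian E') ≤
      ∫ y, (H y + Real.log ((N : ℝ) + 1) / (N + 1)) ∂(stdGaussian E') :=
    integral_mono ((integrable_mul_norm_add_one L').mono'
      (continuous_softMaxInner hs N).aestronglyMeasurable
      (ae_of_all _ (abs_softMaxInner_le hs N))) (hH.add (integrable_const _))
      fun y => softMaxInner_le (fun j => hsH j y) N
  rw [integral_add hH (integrable_const _)] at h2
  simpa using h1.trans h2

end Supremum

/-! ### Symmetrization, rank-one tensors and the operator norm as a supremum. -/

section Tensors

open scoped RealInnerProductSpace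

variable {k n : ℕ}

/-- Tensors with the Frobenius inner product. -/
abbrev TensorSpace (k n : ℕ) : Type := EuclideanSpace ℝ (Fin k → Fin n)

/-- The symmetric noise tensor, as a function on the space of tensors. -/
noncomputable def symNoiseL2 (W : TensorSpace k n) : TensorSpace k n :=
  WithLp.toLp 2 (symNoise W.ofLp)

lemma permute_apply (π : Equiv.Perm (Fin k)) (X : Tensor k n) (i : Fin k → Fin n) :
    permute π X i = X (i ∘ π) := rfl

lemma symNoise_apply (X : Tensor k n) (i : Fin k → Fin n) :
    symNoise X i = 1 / (k ! : ℝ) * √((k : ℝ) / (n : ℝ)) * ∑ π : Equiv.Perm (Fin k), X (i ∘ π) := by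
  simp [symNoise, permute_apply]

lemma sum_comp_perm {M : Type*} [AddCommMonoid M] (π : Equiv.Perm (Fin k))
    (f : (Fin k → Fin n) → M) : ∑ i, f (i ∘ π) = ∑ i, f i :=
  Equiv.sum_comp (Equiv.arrowCongr π.symm (Equiv.refl (Fin n))) f

/-- The adjoint of permuting indices by π is permuting by π⁻¹, and the sum over all π is invariant
under inversion. -/
lemma inner_symNoiseL2_left (W X : TensorSpace k n) :
    ⟪symNoiseL2 W, X⟫ = ⟪W, symNoiseL2 X⟫ := by
  simp only [PiLp.inner_apply, symNoiseL2, symNoise_apply, RCLike.inner_apply, conj_trivial,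
    Finset.mul_sum, Finset.sum_mul]
  rw [Finset.sum_comm, Finset.sum_comm (γ := Fin k → Fin n)]
  refine Fintype.sum_equiv (Equiv.inv _) _ _ fun π => ?_
  rw [← sum_comp_perm π⁻¹]
  refine Finset.sum_congr rfl fun i _ => ?_
  have h : (i ∘ ⇑π⁻¹) ∘ ⇑π = i := by
    ext j
    simp
  rw [h]
  simp only [Equiv.inv_apply]
  ring

/-- An average of k! isometries is a contraction; only the factor √(k/n) remains. -/
lemma norm_symNoiseL2_le (W : TensorSpace k n) :
    ‖symNoiseL2 W‖ ≤ √((k : ℝ) / (n : ℝ)) * ‖W‖ := by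
  have h1 : symNoiseL2 W = (1 / (k ! : ℝ) * √((k : ℝ) / (n : ℝ))) •
      ∑ π : Equiv.Perm (Fin k), (WithLp.toLp 2 (permute π W.ofLp) : TensorSpace k n) := by
    ext i
    simp [symNoiseL2, symNoise]
  have h2 : ∀ π : Equiv.Perm (Fin k), ‖(WithLp.toLp 2 (permute π W.ofLp) : TensorSpace k n)‖ =
      ‖W‖ := by
    intro π
    rw [EuclideanSpace.norm_eq, EuclideanSpace.norm_eq]
    congr 1
    exact sum_comp_perm π fun i => ‖W i‖ ^ 2
  have hk : (0 : ℝ) < k ! := by positivity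
  rw [h1, norm_smul, Real.norm_of_nonneg (by positivity)]
  calc _ ≤ 1 / (k ! : ℝ) * √((k : ℝ) / (n : ℝ)) * ∑ _π : Equiv.Perm (Fin k), ‖W‖ := by
        refine mul_le_mul_of_nonneg_left ((norm_sum_le _ _).trans_eq ?_) (by positivity)
        exact Finset.sum_congr rfl fun π _ => h2 π
    _ = _ := by
        rw [Finset.sum_const, Finset.card_univ, Fintype.card_perm, Fintype.card_fin, nsmul_eq_mul]
        field_simp

lemma symNoiseL2_sub (W X : TensorSpace k n) :
    symNoiseL2 (W - X) = symNoiseL2 W - symNoiseL2 X := by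
  ext i
  simp [symNoiseL2, symNoise_apply, mul_sub]

lemma symNoise_eq_inner (X : TensorSpace k n) (i : Fin k → Fin n) :
    symNoise X.ofLp i = ⟪symNoiseL2 (EuclideanSpace.single i 1), X⟫ := by
  rw [inner_symNoiseL2_left, EuclideanSpace.inner_single_left]
  simp [symNoiseL2]

/-- The entries of the symmetric noise have variance at least `1 / (n (k - 1)!)`. -/
lemma le_norm_sq_symNoiseL2_single (hk : 1 ≤ k) (i : Fin k → Fin n) :
    1 / ((n : ℝ) * (k - 1)!) ≤ ‖symNoiseL2 (EuclideanSpace.single i (1 : ℝ))‖ ^ 2 := by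
  classical
  have hk0 : (0 : ℝ) < k ! := by positivity
  set N : (Fin k → Fin n) → ℕ := fun j =>
    (Finset.univ.filter fun π : Equiv.Perm (Fin k) => j ∘ π = i).card with hN
  have h1 : ∀ j, symNoiseL2 (EuclideanSpace.single i (1 : ℝ)) j =
      1 / (k ! : ℝ) * √((k : ℝ) / (n : ℝ)) * N j := by
    intro j
    simp [symNoiseL2, symNoise_apply, hN, Pi.single_apply]
  have h2 : ∑ j, N j = k ! := by
    simp only [hN, Finset.card_filter]
    rw [Finset.sum_comm]
    have h3 : ∀ π : Equiv.Perm (Fin k), ∑ j : Fin k → Fin n, (if j ∘ π = i then 1 else 0) = 1 := by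
      intro π
      rw [sum_comp_perm π fun j => if j = i then 1 else 0]
      simp
    simp [h3, Fintype.card_perm]
  -- The counts N j are natural numbers, so N j ≤ (N j)². Equality holds when i has distinct
  -- entries; repeated entries only increase the variance.
  have h3 : (k ! : ℝ) ≤ ∑ j, (N j : ℝ) ^ 2 := by
    rw [← h2]
    push_cast
    refine Finset.sum_le_sum fun j _ => ?_
    exact_mod_cast Nat.le_self_pow two_ne_zero (N j)
  have h4 : (k ! : ℝ) = k * (k - 1)! := by
    exact_mod_cast (Nat.mul_factorial_pred (by omega)).symm
  have h5 : (0 : ℝ) < k := by exact_mod_cast hk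
  rw [EuclideanSpace.real_norm_sq_eq]
  simp only [h1, mul_pow, ← Finset.mul_sum]
  rw [Real.sq_sqrt (by positivity)]
  calc 1 / ((n : ℝ) * (k - 1)!) = (1 / (k ! : ℝ)) ^ 2 * (k / n) * k ! := by
        rw [h4]
        field_simp
    _ ≤ _ := mul_le_mul_of_nonneg_left h3 (by positivity)

/-- The tensor index with given row and column indices in the unfolding. -/
def unfoldIndex {q : ℕ} (a : Fin (n ^ q)) (b : Fin (n ^ (k - q))) (j : Fin k) : Fin n :=
  if h : (j : ℕ) < q then finFunctionFinEquiv.symm a ⟨j, h⟩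
  else finFunctionFinEquiv.symm b ⟨j - q, by omega⟩

lemma unfolding_apply {q : ℕ} (X : Tensor k n) (a : Fin (n ^ q)) (b : Fin (n ^ (k - q))) :
    unfolding q X a b = X (unfoldIndex a b) := rfl

/-- Tensor indices correspond to pairs of row and column indices of the unfolding. -/
def unfoldEquiv {q : ℕ} (hq : q ≤ k) :
    (Fin (n ^ q) × Fin (n ^ (k - q))) ≃ (Fin k → Fin n) where
  toFun p := unfoldIndex p.1 p.2
  invFun i := (finFunctionFinEquiv fun j => i ⟨j, by omega⟩,
    finFunctionFinEquiv fun j => i ⟨q + j, by omega⟩)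
  left_inv p := by
    ext1
    · rw [← Equiv.eq_symm_apply]
      ext j
      simp [unfoldIndex]
    · rw [← Equiv.eq_symm_apply]
      ext j
      simp [unfoldIndex]
  right_inv i := by
    ext j
    by_cases h : (j : ℕ) < q
    · simp [unfoldIndex, h]
    · simp only [unfoldIndex, h, dif_neg, not_false_eq_true, Equiv.symm_apply_apply]
      congr 3
      omega

/-- The tensor whose unfolding is the rank one matrix `u vᵀ`. -/
noncomputable def rankOne {q : ℕ} (hq : q ≤ k) (u : EuclideanSpace ℝ (Fin (n ^ q)))
    (v : EuclideanSpace ℝ (Fin (n ^ (k - q)))) : TensorSpace k n :=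
  WithLp.toLp 2 fun i => u ((unfoldEquiv hq).symm i).1 * v ((unfoldEquiv hq).symm i).2

variable {q : ℕ} (hq : q ≤ k)

lemma inner_rankOne_left (u : EuclideanSpace ℝ (Fin (n ^ q)))
    (v : EuclideanSpace ℝ (Fin (n ^ (k - q)))) (X : TensorSpace k n) :
    ⟪rankOne hq u v, X⟫ = ⟪u, Matrix.toEuclideanLin (unfolding q X.ofLp) v⟫ := by
  simp only [PiLp.inner_apply, rankOne, RCLike.inner_apply, conj_trivial,
    Matrix.toLpLin_apply, Matrix.mulVec, dotProduct, Finset.sum_mul]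
  rw [← (unfoldEquiv hq).sum_comp, Fintype.sum_prod_type]
  refine Finset.sum_congr rfl fun a _ => Finset.sum_congr rfl fun b _ => ?_
  rw [Equiv.symm_apply_apply, unfolding_apply]
  simp only [unfoldEquiv, Equiv.coe_fn_mk]
  ring

lemma inner_rankOne_rankOne (u u' : EuclideanSpace ℝ (Fin (n ^ q)))
    (v v' : EuclideanSpace ℝ (Fin (n ^ (k - q)))) :
    ⟪rankOne hq u v, rankOne hq u' v'⟫ = ⟪u, u'⟫ * ⟪v, v'⟫ := by
  simp only [PiLp.inner_apply, rankOne, RCLike.inner_apply, conj_trivial]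
  rw [← (unfoldEquiv hq).sum_comp, Fintype.sum_prod_type, Finset.sum_mul_sum]
  refine Finset.sum_congr rfl fun a _ => Finset.sum_congr rfl fun b _ => ?_
  rw [Equiv.symm_apply_apply]
  ring

lemma norm_rankOne (u : EuclideanSpace ℝ (Fin (n ^ q)))
    (v : EuclideanSpace ℝ (Fin (n ^ (k - q)))) : ‖rankOne hq u v‖ = ‖u‖ * ‖v‖ := by
  have h := inner_rankOne_rankOne hq u u v v
  rw [real_inner_self_eq_norm_sq, real_inner_self_eq_norm_sq, real_inner_self_eq_norm_sq,
    ← mul_pow] at h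
  exact (pow_left_inj₀ (norm_nonneg _) (by positivity) two_ne_zero).1 h

/-- With a = ⟪u, u'⟫ and b = ⟪v, v'⟫, the two sides differ by 2(1 - a)(1 - b) ≥ 0. This is the
increment comparison behind the upper bound. -/
lemma norm_rankOne_sub_sq_le {u u' : EuclideanSpace ℝ (Fin (n ^ q))}
    {v v' : EuclideanSpace ℝ (Fin (n ^ (k - q)))} (hu : ‖u‖ = 1) (hu' : ‖u'‖ = 1)
    (hv : ‖v‖ = 1) (hv' : ‖v'‖ = 1) :
    ‖rankOne hq u v - rankOne hq u' v'‖ ^ 2 ≤ ‖u - u'‖ ^ 2 + ‖v - v'‖ ^ 2 := by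
  rw [norm_sub_sq_real, norm_sub_sq_real, norm_sub_sq_real, inner_rankOne_rankOne, norm_rankOne,
    norm_rankOne, hu, hu', hv, hv']
  have h1 := real_inner_le_norm u u'
  have h2 := real_inner_le_norm v v'
  rw [hu, hu'] at h1
  rw [hv, hv'] at h2
  nlinarith

/-- The operator norm is the supremum of the bilinear form over a dense set of unit vectors. -/
lemma isLUB_opNorm {m p : ℕ} {d : ℕ → Metric.sphere (0 : EuclideanSpace ℝ (Fin m)) 1 ×
    Metric.sphere (0 : EuclideanSpace ℝ (Fin p)) 1} (hd : DenseRange d)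
    (A : Matrix (Fin m) (Fin p) ℝ) :
    IsLUB (Set.range fun j => ⟪((d j).1 : EuclideanSpace ℝ (Fin m)),
      Matrix.toEuclideanLin A (d j).2⟫) (opNorm A) := by
  set T := LinearMap.toContinuousLinearMap (Matrix.toEuclideanLin A) with hT
  have hTA : ∀ v, Matrix.toEuclideanLin A v = T v := fun v => rfl
  have hcont : Continuous fun z : Metric.sphere (0 : EuclideanSpace ℝ (Fin m)) 1 ×
      Metric.sphere (0 : EuclideanSpace ℝ (Fin p)) 1 =>
      ⟪(z.1 : EuclideanSpace ℝ (Fin m)), T z.2⟫ := by fun_prop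
  simp only [hTA]
  refine ⟨?_, fun c hc => ?_⟩
  · rintro _ ⟨j, rfl⟩
    refine (real_inner_le_norm _ _).trans ?_
    have h1 : ‖((d j).1 : EuclideanSpace ℝ (Fin m))‖ = 1 := by simp
    have h2 : ‖((d j).2 : EuclideanSpace ℝ (Fin p))‖ = 1 := by simp
    have h3 := T.le_opNorm (d j).2
    rw [h2, mul_one] at h3
    rw [h1, one_mul]
    exact h3
  · have hall : ∀ z, ⟪((z : Metric.sphere (0 : EuclideanSpace ℝ (Fin m)) 1 ×
        Metric.sphere (0 : EuclideanSpace ℝ (Fin p)) 1).1 : EuclideanSpace ℝ (Fin m)),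
        T z.2⟫ ≤ c := fun z => by
      refine hd.induction_on (p := fun z => ⟪(z.1 : EuclideanSpace ℝ (Fin m)), T z.2⟫ ≤ c) z
        (isClosed_le hcont continuous_const) fun j => hc ⟨j, rfl⟩
    -- Changing the sign of u changes the sign of the form, so an upper bound for all pairs is
    -- nonnegative.
    have hc0 : 0 ≤ c := by
      have h1 := hall (d 0)
      have h2 : ⟪-((d 0).1 : EuclideanSpace ℝ (Fin m)), T (d 0).2⟫ ≤ c :=
        hall (-(d 0).1, (d 0).2)
      rw [inner_neg_left] at h2
      linarith
    refine ContinuousLinearMap.opNorm_le_bound _ hc0 fun v => ?_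
    by_cases hv : T v = 0
    · rw [hv, norm_zero]; positivity
    have hv0 : v ≠ 0 := fun h => hv (by rw [h, map_zero])
    have h1 := hall (⟨‖T v‖⁻¹ • T v, by simp [norm_smul, hv]⟩, ⟨‖v‖⁻¹ • v, by simp [norm_smul, hv0]⟩)
    simp only [map_smul, real_inner_smul_left, real_inner_smul_right,
      real_inner_self_eq_norm_sq] at h1
    have h2 : 0 < ‖T v‖ := norm_pos_iff.2 hv
    have h3 : 0 < ‖v‖ := norm_pos_iff.2 hv0
    field_simp at h1
    rw [mul_comm]
    exact h1

end Tensors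

/-! ### Two-sided bounds on the mean of the unfolding norm. -/

section Norms

open scoped RealInnerProductSpace

/-- Integrate y²/2 + 2 ≤ exp y + exp(-y) at y = X/√c: each exponential has mean at most exp(1/2) ≤
2, leaving a second moment of at most 4c. This 4 is the one in the final constant 4 k!. -/
lemma integral_sq_le_of_hasSubgaussianMGF {Ω : Type*} [MeasurableSpace Ω] {μ : Measure Ω}
    [IsProbabilityMeasure μ] {X : Ω → ℝ} {c : NNReal} (h : HasSubgaussianMGF X c μ) (hc : 0 < c) :
    ∫ ω, X ω ^ 2 ∂μ ≤ 4 * c := by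
  have hc' : (0 : ℝ) < c := hc
  set a : ℝ := (√c)⁻¹ with ha
  have ha2 : a ^ 2 = (c : ℝ)⁻¹ := by rw [ha, inv_pow, Real.sq_sqrt hc'.le]
  have hX2 : Integrable (fun ω => X ω ^ 2) μ := (h.memLp 2).integrable_sq
  have hexp : Real.exp (1 / 2) ≤ 2 := by
    have h1 := Real.add_one_le_exp (-(1 / 2) : ℝ)
    have h2 : Real.exp (1 / 2) * Real.exp (-(1 / 2)) = 1 := by rw [← Real.exp_add]; simp
    nlinarith [Real.exp_pos (1 / 2 : ℝ)]
  have hmgf : ∀ b : ℝ, b ^ 2 = (c : ℝ)⁻¹ → ∫ ω, Real.exp (b * X ω) ∂μ ≤ 2 := fun b hb => by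
    have h1 := h.mgf_le b
    rw [mgf, hb, mul_inv_cancel₀ hc'.ne'] at h1
    exact h1.trans hexp
  have hpt : ∀ ω, a ^ 2 / 2 * X ω ^ 2 + 2 ≤ Real.exp (a * X ω) + Real.exp (-a * X ω) := by
    intro ω
    have key : ∀ y : ℝ, 0 ≤ y → y ^ 2 / 2 + 2 ≤ Real.exp y + Real.exp (-y) := fun y hy => by
      have h1 := Real.quadratic_le_exp_of_nonneg hy
      have h2 := Real.add_one_le_exp (-y)
      linarith
    have h1 := key |a * X ω| (abs_nonneg _)
    rw [sq_abs, mul_pow] at h1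
    rcases abs_choice (a * X ω) with h2 | h2 <;> rw [h2] at h1
    · rw [neg_mul]; linarith
    · rw [neg_neg] at h1; rw [neg_mul]; linarith
  have h1 : ∫ ω, (a ^ 2 / 2 * X ω ^ 2 + 2) ∂μ ≤
      ∫ ω, (Real.exp (a * X ω) + Real.exp (-a * X ω)) ∂μ :=
    integral_mono ((hX2.const_mul _).add (integrable_const _))
      ((h.integrable_exp_mul a).add (h.integrable_exp_mul (-a))) hpt
  rw [integral_add (h.integrable_exp_mul a) (h.integrable_exp_mul (-a)),
    integral_add (hX2.const_mul _) (integrable_const _), integral_const_mul] at h1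
  have h2 := hmgf a ha2
  have h3 := hmgf (-a) (by rw [neg_sq, ha2])
  have h4 : a ^ 2 / 2 * ∫ ω, X ω ^ 2 ∂μ ≤ 2 := by
    simp only [integral_const, probReal_univ, one_smul] at h1
    linarith
  rw [ha2] at h4
  field_simp at h4
  linarith

lemma measureReal_abs_ge_le {Ω : Type*} [MeasurableSpace Ω] {μ : Measure Ω}
    [IsProbabilityMeasure μ] {X : Ω → ℝ} {c : NNReal} (h : HasSubgaussianMGF X c μ) {t : ℝ}
    (ht : 0 ≤ t) : μ.real {ω | t ≤ |X ω|} ≤ 2 * Real.exp (-t ^ 2 / (2 * c)) := by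
  have h1 : {ω | t ≤ |X ω|} = {ω | t ≤ X ω} ∪ {ω | t ≤ (-X) ω} := by
    ext ω
    simp [le_abs]
  rw [h1, two_mul]
  exact (measureReal_union_le _ _).trans (add_le_add (h.measure_ge_le ht) (h.neg.measure_ge_le ht))

/-- The squared norm has mean `card κ`, and nonnegativity of the variance bounds the squared mean by
it. Embedding κ in ι covers both blocks of a direct sum. -/
lemma integral_norm_coordinates_le {ι κ : Type*} [Fintype ι] [Fintype κ] (e : κ ↪ ι) :
    Integrable (fun y : EuclideanSpace ℝ ι => √(∑ a, y (e a) ^ 2))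
      (stdGaussian (EuclideanSpace ℝ ι)) ∧
    ∫ y : EuclideanSpace ℝ ι, √(∑ a, y (e a) ^ 2) ∂(stdGaussian (EuclideanSpace ℝ ι)) ≤
      √(Fintype.card κ) := by
  classical
  set γ := stdGaussian (EuclideanSpace ℝ ι)
  have hcont : Continuous fun y : EuclideanSpace ℝ ι => √(∑ a, y (e a) ^ 2) := by fun_prop
  have hle : ∀ y : EuclideanSpace ℝ ι, √(∑ a, y (e a) ^ 2) ≤ ‖y‖ := fun y => by
    rw [EuclideanSpace.norm_eq]
    refine Real.sqrt_le_sqrt ?_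
    simp only [Real.norm_eq_abs, sq_abs]
    rw [← Finset.sum_map Finset.univ e fun i => y i ^ 2]
    exact Finset.sum_le_univ_sum_of_nonneg fun i => sq_nonneg _
  have hmem : MemLp (fun y : EuclideanSpace ℝ ι => √(∑ a, y (e a) ^ 2)) 2 γ :=
    (IsGaussian.memLp_two_id (μ := γ)).mono hcont.aestronglyMeasurable (ae_of_all _ fun y => by
      rw [Real.norm_of_nonneg (Real.sqrt_nonneg _)]; exact hle y)
  refine ⟨hmem.integrable (by norm_num), ?_⟩
  have hcoord : ∀ i, ∫ y : EuclideanSpace ℝ ι, y i ^ 2 ∂γ = 1 := fun i => by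
    have h := integral_inner_sq_stdGaussian (EuclideanSpace.single i (1 : ℝ))
    simpa [EuclideanSpace.inner_single_left] using h
  have hcint : ∀ i, Integrable (fun y : EuclideanSpace ℝ ι => y i ^ 2) γ := fun i =>
    MeasureTheory.Integrable.of_integral_ne_zero (by rw [hcoord]; norm_num)
  have h1 := variance_nonneg (fun y : EuclideanSpace ℝ ι => √(∑ a, y (e a) ^ 2)) γ
  rw [variance_eq_sub hmem] at h1
  have h2 : ∫ y : EuclideanSpace ℝ ι, √(∑ a, y (e a) ^ 2) ^ 2 ∂γ = Fintype.card κ := by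
    have h3 : ∀ y : EuclideanSpace ℝ ι, √(∑ a, y (e a) ^ 2) ^ 2 = ∑ a, y (e a) ^ 2 := fun y =>
      Real.sq_sqrt (Finset.sum_nonneg fun _ _ => sq_nonneg _)
    simp only [h3]
    rw [integral_finsetSum _ fun a _ => hcint (e a)]
    simp [hcoord]
  simp only [Pi.pow_apply] at h1
  rw [h2] at h1
  exact Real.le_sqrt_of_sq_le (by linarith)

variable {k n q : ℕ}

/-- The unfolding operator norm as a supremum of linear forms of the tensor. -/
lemma exists_isLUB_noiseNorm (hn : 1 ≤ n) (hq : q ≤ k) :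
    ∃ (u : ℕ → EuclideanSpace ℝ (Fin (n ^ q))) (v : ℕ → EuclideanSpace ℝ (Fin (n ^ (k - q)))),
      (∀ j, ‖u j‖ = 1) ∧ (∀ j, ‖v j‖ = 1) ∧ ∀ X : TensorSpace k n,
        IsLUB (Set.range fun j => ⟪symNoiseL2 (rankOne hq (u j) (v j)), X⟫)
          (noiseNorm q X.ofLp) := by
  -- A dense sequence of unit vectors exists only if the spheres are nonempty; this is where n ≥ 1
  -- matters.
  have hne : ∀ m, Nonempty (Metric.sphere (0 : EuclideanSpace ℝ (Fin (n ^ m))) 1) := fun m =>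
    ⟨EuclideanSpace.single ⟨0, by positivity⟩ 1, by simp⟩
  have h1 := hne q
  have h2 := hne (k - q)
  set d := TopologicalSpace.denseSeq (Metric.sphere (0 : EuclideanSpace ℝ (Fin (n ^ q))) 1 ×
    Metric.sphere (0 : EuclideanSpace ℝ (Fin (n ^ (k - q)))) 1)
  refine ⟨fun j => (d j).1, fun j => (d j).2, fun j => by simp, fun j => by simp, fun X => ?_⟩
  have h := isLUB_opNorm (TopologicalSpace.denseRange_denseSeq _ : DenseRange d)
    (unfolding q (symNoise X.ofLp))
  change IsLUB _ (opNorm (unfolding q (symNoise X.ofLp)))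
  convert h using 3
  rw [inner_symNoiseL2_left, inner_rankOne_left]
  rfl

lemma norm_symNoiseL2_rankOne_le (hq : q ≤ k) {u : EuclideanSpace ℝ (Fin (n ^ q))}
    {v : EuclideanSpace ℝ (Fin (n ^ (k - q)))} (hu : ‖u‖ = 1) (hv : ‖v‖ = 1) :
    ‖symNoiseL2 (rankOne hq u v)‖ ≤ √((k : ℝ) / n) := by
  have h := norm_symNoiseL2_le (rankOne hq u v)
  rwa [norm_rankOne, hu, hv, mul_one, mul_one] at h

lemma integrable_noiseNorm (hn : 1 ≤ n) (hq : q ≤ k) :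
    Integrable (fun X : TensorSpace k n => noiseNorm q X.ofLp) (stdGaussian (TensorSpace k n)) := by
  obtain ⟨u, v, hu, hv, h⟩ := exists_isLUB_noiseNorm hn hq
  exact integrable_of_isLUB (fun j => norm_symNoiseL2_rankOne_le hq (hu j) (hv j)) h

lemma hasSubgaussianMGF_noiseNorm (hn : 1 ≤ n) (hq : q ≤ k) :
    HasSubgaussianMGF (fun X : TensorSpace k n => noiseNorm q X.ofLp -
      ∫ Y, noiseNorm q Y.ofLp ∂(stdGaussian (TensorSpace k n))) ((k : ℝ) / n).toNNReal
      (stdGaussian (TensorSpace k n)) := by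
  obtain ⟨u, v, hu, hv, h⟩ := exists_isLUB_noiseNorm hn hq
  have h1 := hasSubgaussianMGF_of_isLUB
    (fun j => norm_symNoiseL2_rankOne_le hq (hu j) (hv j)) h
  rwa [Real.sq_sqrt (by positivity)] at h1

lemma integral_noiseNorm_le (hn : 1 ≤ n) (hq : q ≤ k) :
    ∫ X, noiseNorm q X.ofLp ∂(stdGaussian (TensorSpace k n)) ≤
      √((k : ℝ) / n) * (√((n : ℝ) ^ q) + √((n : ℝ) ^ (k - q))) := by
  obtain ⟨u, v, hu, hv, h⟩ := exists_isLUB_noiseNorm hn hq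
  set c := √((k : ℝ) / n) with hc
  have hc0 : 0 ≤ c := Real.sqrt_nonneg _
  -- The comparison family (u, v) in the direct sum decouples rows from columns: its squared
  -- increments are ‖u - u'‖² + ‖v - v'‖², and by Cauchy-Schwarz its forms are at most the sum of
  -- the norms of the two Gaussian blocks.
  set W : ℕ → EuclideanSpace ℝ (Fin (n ^ q) ⊕ Fin (n ^ (k - q))) := fun j =>
    WithLp.toLp 2 (Sum.elim (u j) (v j)) with hW
  have hWsub : ∀ i j, ‖W i - W j‖ ^ 2 = ‖u i - u j‖ ^ 2 + ‖v i - v j‖ ^ 2 := fun i j => by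
    simp [hW, EuclideanSpace.real_norm_sq_eq, Fintype.sum_sum_type]
  have hWnorm : ∀ j, ‖c • W j‖ ≤ c * √2 := fun j => by
    rw [norm_smul, Real.norm_of_nonneg hc0]
    refine mul_le_mul_of_nonneg_left (Real.le_sqrt_of_sq_le (le_of_eq ?_)) hc0
    have h1 : ‖W j‖ ^ 2 = ‖u j‖ ^ 2 + ‖v j‖ ^ 2 := by
      simp [hW, EuclideanSpace.real_norm_sq_eq, Fintype.sum_sum_type]
    rw [h1, hu, hv]
    norm_num
  have hcomp : ∀ i j, ‖symNoiseL2 (rankOne hq (u i) (v i)) - symNoiseL2 (rankOne hq (u j) (v j))‖ ≤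
      ‖c • W i - c • W j‖ := fun i j => by
    rw [← symNoiseL2_sub, ← smul_sub, norm_smul, Real.norm_of_nonneg hc0]
    refine (norm_symNoiseL2_le _).trans (mul_le_mul_of_nonneg_left ?_ hc0)
    refine (pow_le_pow_iff_left₀ (norm_nonneg _) (norm_nonneg _) two_ne_zero).1 ?_
    rw [hWsub]
    exact norm_rankOne_sub_sq_le hq (hu i) (hu j) (hv i) (hv j)
  have hl := integral_norm_coordinates_le
    (Function.Embedding.inl : Fin (n ^ q) ↪ Fin (n ^ q) ⊕ Fin (n ^ (k - q)))
  have hr := integral_norm_coordinates_le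
    (Function.Embedding.inr : Fin (n ^ (k - q)) ↪ Fin (n ^ q) ⊕ Fin (n ^ (k - q)))
  have hcs : ∀ (m : ℕ) (a b : Fin m → ℝ), ∑ i, a i ^ 2 = 1 → ∑ i, b i * a i ≤ √(∑ i, b i ^ 2) :=
    fun m a b ha => by
      refine Real.le_sqrt_of_sq_le ((Finset.sum_mul_sq_le_sq_mul_sq _ _ _).trans_eq ?_)
      rw [ha, mul_one]
  have hmain := integral_le_of_norm_sub_le
    (fun j => norm_symNoiseL2_rankOne_le hq (hu j) (hv j)) h hWnorm hcomp
    (H := fun y => c * (√(∑ a, y (Function.Embedding.inl a) ^ 2) +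
      √(∑ b, y (Function.Embedding.inr b) ^ 2)))
    ((hl.1.add hr.1).const_mul c) (fun j y => by
      rw [real_inner_smul_left]
      refine mul_le_mul_of_nonneg_left ?_ hc0
      simp only [PiLp.inner_apply, RCLike.inner_apply, conj_trivial, Fintype.sum_sum_type, hW,
        Sum.elim_inl, Sum.elim_inr, Function.Embedding.inl_apply, Function.Embedding.inr_apply]
      refine add_le_add (hcs _ _ _ ?_) (hcs _ _ _ ?_)
      · rw [← EuclideanSpace.real_norm_sq_eq, hu, one_pow]
      · rw [← EuclideanSpace.real_norm_sq_eq, hv, one_pow])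
  rw [integral_const_mul, integral_add hl.1 hr.1] at hmain
  refine hmain.trans (mul_le_mul_of_nonneg_left ?_ hc0)
  have h1 := hl.2
  have h2 := hr.2
  simp only [Fintype.card_fin, Nat.cast_pow] at h1 h2
  exact add_le_add h1 h2

/-- The operator norm dominates the norm of each column and each row. -/
lemma sum_sq_le_opNorm_sq {m p : ℕ} (A : Matrix (Fin m) (Fin p) ℝ) :
    (∀ b, ∑ a, A a b ^ 2 ≤ opNorm A ^ 2) ∧ ∀ a, ∑ b, A a b ^ 2 ≤ opNorm A ^ 2 := by
  set T := LinearMap.toContinuousLinearMap (Matrix.toEuclideanLin A) with hT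
  have hcol : ∀ b, ∑ a, A a b ^ 2 ≤ opNorm A ^ 2 := fun b => by
    have h1 := T.le_opNorm (EuclideanSpace.single b 1)
    rw [PiLp.norm_single, norm_one, mul_one] at h1
    have h2 : ‖T (EuclideanSpace.single b 1)‖ ^ 2 = ∑ a, A a b ^ 2 := by
      rw [EuclideanSpace.real_norm_sq_eq]
      refine Finset.sum_congr rfl fun a _ => ?_
      simp [hT, Matrix.toLpLin_apply]
    rw [← h2]
    exact pow_le_pow_left₀ (norm_nonneg _) h1 2
  refine ⟨hcol, fun a => ?_⟩
  set r : EuclideanSpace ℝ (Fin p) := WithLp.toLp 2 (A a) with hr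
  have h0 : ‖r‖ ^ 2 = ∑ b, A a b ^ 2 := by
    rw [EuclideanSpace.real_norm_sq_eq]
  have h1 : (T r) a = ‖r‖ ^ 2 := by
    rw [h0]
    simp [hT, hr, Matrix.toLpLin_apply, Matrix.mulVec, dotProduct, sq]
  have h2 : ‖r‖ ^ 2 ≤ opNorm A * ‖r‖ := by
    rw [← h1]
    exact (le_abs_self _).trans ((PiLp.norm_apply_le (T r) a).trans (T.le_opNorm r))
  rw [← h0]
  rcases eq_or_lt_of_le (norm_nonneg r) with h3 | h3
  · rw [← h3, zero_pow two_ne_zero]; positivity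
  · have h4 : ‖r‖ ≤ opNorm A := by
      rw [sq] at h2
      exact le_of_mul_le_mul_right h2 h3
    exact pow_le_pow_left₀ h3.le h4 2

lemma opNorm_nonneg {m p : ℕ} (A : Matrix (Fin m) (Fin p) ℝ) : 0 ≤ opNorm A := norm_nonneg _

lemma integrable_symNoise_sq (i : Fin k → Fin n) :
    Integrable (fun X : TensorSpace k n => symNoise X.ofLp i ^ 2)
      (stdGaussian (TensorSpace k n)) := by
  simp only [symNoise_eq_inner]
  exact (IsGaussian.memLp_dual (stdGaussian (TensorSpace k n))
    (innerSL ℝ (symNoiseL2 (EuclideanSpace.single i 1))) 2 (by norm_num)).integrable_sq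

lemma le_integral_symNoise_sq (hk : 1 ≤ k) (i : Fin k → Fin n) :
    1 / ((n : ℝ) * (k - 1)!) ≤
      ∫ X, symNoise X.ofLp i ^ 2 ∂(stdGaussian (TensorSpace k n)) := by
  simp only [symNoise_eq_inner]
  rw [integral_inner_sq_stdGaussian]
  exact le_norm_sq_symNoiseL2_single hk i

/-- With B = n^M/(n (k-1)!) and M = max(q, k-q), the longest row or column gives second moment at
least B, while the variance is at most 4k/n. Hence m² ≥ B - 4k/n. -/
lemma le_integral_noiseNorm (hk : 1 ≤ k) (hn : 1 ≤ n) (hq : q ≤ k) :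
    √((n : ℝ) ^ max q (k - q) / (n * (k - 1)!)) * (1 - 4 * (k ! : ℝ) / (n : ℝ) ^ max q (k - q)) ≤
      ∫ X, noiseNorm q X.ofLp ∂(stdGaussian (TensorSpace k n)) := by
  set γ := stdGaussian (TensorSpace k n) with hγ
  set m := ∫ X, noiseNorm q X.ofLp ∂γ with hm
  have hm0 : 0 ≤ m := integral_nonneg fun X => opNorm_nonneg _
  have hk0 : (0 : ℝ) < k := by exact_mod_cast hk
  have hn0 : (0 : ℝ) < n := by exact_mod_cast hn
  have hsub := hasSubgaussianMGF_noiseNorm hn hq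
  have hvar := integral_sq_le_of_hasSubgaussianMGF hsub
    (Real.toNNReal_pos.2 (by positivity))
  rw [Real.coe_toNNReal _ (by positivity)] at hvar
  have hint := integrable_noiseNorm hn hq
  have hsq : Integrable (fun X : TensorSpace k n => (noiseNorm q X.ofLp - m) ^ 2) γ :=
    (hsub.memLp 2).integrable_sq
  have heq : ∀ X : TensorSpace k n, noiseNorm q X.ofLp ^ 2 =
      (noiseNorm q X.ofLp - m) ^ 2 + (2 * m * noiseNorm q X.ofLp - m ^ 2) := fun X => by ring
  have hlin : Integrable (fun X : TensorSpace k n => 2 * m * noiseNorm q X.ofLp - m ^ 2) γ :=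
    (hint.const_mul _).sub (integrable_const _)
  have hsqi : Integrable (fun X : TensorSpace k n => noiseNorm q X.ofLp ^ 2) γ := by
    simp only [heq]
    exact hsq.add hlin
  have hupper : ∫ X, noiseNorm q X.ofLp ^ 2 ∂γ ≤ m ^ 2 + 4 * (k / n) := by
    simp only [heq]
    rw [integral_add hsq hlin, integral_sub (hint.const_mul _) (integrable_const _),
      integral_const_mul, ← hm]
    simp only [integral_const, probReal_univ, one_smul]
    linarith
  have hcol : (n : ℝ) ^ q / (n * (k - 1)!) ≤ ∫ X, noiseNorm q X.ofLp ^ 2 ∂γ := by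
    set b : Fin (n ^ (k - q)) := ⟨0, by positivity⟩
    calc (n : ℝ) ^ q / (n * (k - 1)!) = ∑ _a : Fin (n ^ q), 1 / ((n : ℝ) * (k - 1)!) := by
          simp [div_eq_mul_inv]
      _ ≤ ∑ a, ∫ X, symNoise X.ofLp (unfoldIndex a b) ^ 2 ∂γ :=
          Finset.sum_le_sum fun a _ => le_integral_symNoise_sq hk _
      _ = ∫ X, ∑ a, symNoise X.ofLp (unfoldIndex a b) ^ 2 ∂γ :=
          (integral_finsetSum _ fun a _ => integrable_symNoise_sq _).symm
      _ ≤ _ := integral_mono (integrable_finsetSum _ fun a _ => integrable_symNoise_sq _) hsqi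
          fun X => (sum_sq_le_opNorm_sq (unfolding q (symNoise X.ofLp))).1 b
  have hrow : (n : ℝ) ^ (k - q) / (n * (k - 1)!) ≤ ∫ X, noiseNorm q X.ofLp ^ 2 ∂γ := by
    set a : Fin (n ^ q) := ⟨0, by positivity⟩
    calc (n : ℝ) ^ (k - q) / (n * (k - 1)!) =
          ∑ _b : Fin (n ^ (k - q)), 1 / ((n : ℝ) * (k - 1)!) := by
          simp [div_eq_mul_inv]
      _ ≤ ∑ b, ∫ X, symNoise X.ofLp (unfoldIndex a b) ^ 2 ∂γ :=
          Finset.sum_le_sum fun b _ => le_integral_symNoise_sq hk _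
      _ = ∫ X, ∑ b, symNoise X.ofLp (unfoldIndex a b) ^ 2 ∂γ :=
          (integral_finsetSum _ fun b _ => integrable_symNoise_sq _).symm
      _ ≤ _ := integral_mono (integrable_finsetSum _ fun b _ => integrable_symNoise_sq _) hsqi
          fun X => (sum_sq_le_opNorm_sq (unfolding q (symNoise X.ofLp))).2 a
  have hmax : (n : ℝ) ^ max q (k - q) / (n * (k - 1)!) ≤ ∫ X, noiseNorm q X.ofLp ^ 2 ∂γ := by
    rcases max_choice q (k - q) with h | h <;> rw [h] <;> assumption
  set M := max q (k - q)
  -- Chosen so that Bx = 4k/n. When x ≤ 1, m² ≥ B(1 - x) ≥ B(1 - x)² and a square root can be taken;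
  -- otherwise the bound is nonpositive.
  set x := 4 * (k ! : ℝ) / (n : ℝ) ^ M with hx
  rcases le_total (1 - x) 0 with h1 | h1
  · exact (mul_nonpos_of_nonneg_of_nonpos (Real.sqrt_nonneg _) h1).trans hm0
  · refine (pow_le_pow_iff_left₀ (mul_nonneg (Real.sqrt_nonneg _) h1) hm0 two_ne_zero).1 ?_
    have hB : (0 : ℝ) ≤ (n : ℝ) ^ M / (n * (k - 1)!) := by positivity
    rw [mul_pow, Real.sq_sqrt hB]
    have hx0 : 0 ≤ x := by positivity
    have h2 : (1 - x) ^ 2 ≤ 1 - x := by nlinarith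
    have h3 : (n : ℝ) ^ M / (n * (k - 1)!) * x = 4 * (k / n) := by
      have h4 : (k ! : ℝ) = k * (k - 1)! := by
        exact_mod_cast (Nat.mul_factorial_pred (by omega)).symm
      rw [hx, h4]
      field_simp
    calc (n : ℝ) ^ M / (n * (k - 1)!) * (1 - x) ^ 2 ≤ (n : ℝ) ^ M / (n * (k - 1)!) * (1 - x) :=
          mul_le_mul_of_nonneg_left h2 hB
      _ = (n : ℝ) ^ M / (n * (k - 1)!) - 4 * (k / n) := by rw [mul_sub, h3, mul_one]
      _ ≤ m ^ 2 := by linarith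

end Norms

/-! ### Closed forms of the two bounds and their minimization over q. -/

section Bounds

variable {k n q : ℕ}

lemma lowerBound_eq (hn : 1 ≤ n) (hq : q ≤ k) (C : ℝ) :
    lowerBound C k n q = √((n : ℝ) ^ max q (k - q) / (n * (k - 1)!)) *
      (1 - C / (n : ℝ) ^ max q (k - q)) := by
  have hn0 : (0 : ℝ) < n := by exact_mod_cast hn
  have h1 : max (q : ℝ) ((k : ℝ) - q) = ((max q (k - q) : ℕ) : ℝ) := by
    rw [Nat.cast_max, Nat.cast_sub hq]
  have h2 : max ((q : ℝ) - 1) ((k : ℝ) - q - 1) = ((max q (k - q) : ℕ) : ℝ) - 1 := by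
    rw [← h1, max_sub_sub_right]
  have h3 : (n : ℝ) ^ ((((max q (k - q) : ℕ) : ℝ) - 1) / 2) = √((n : ℝ) ^ max q (k - q) / n) := by
    rw [Real.sqrt_eq_rpow, ← Real.rpow_natCast, ← Real.rpow_sub_one hn0.ne', ← Real.rpow_mul hn0.le]
    congr 1
    ring
  rw [lowerBound, h2, h1, h3, Real.rpow_natCast, ← div_div,
    Real.sqrt_div' ((n : ℝ) ^ max q (k - q) / n) (by positivity)]
  ring

lemma upperBound_eq (hn : 1 ≤ n) (hq : q ≤ k) :
    upperBound k n q = √((k : ℝ) / n) * (√((n : ℝ) ^ q) + √((n : ℝ) ^ (k - q))) := by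
  have hn0 : (0 : ℝ) < n := by exact_mod_cast hn
  have h3 : ∀ m : ℕ, (n : ℝ) ^ (((m : ℝ) - 1) / 2) = √((n : ℝ) ^ m) / √n := fun m => by
    rw [← Real.sqrt_div' _ hn0.le, Real.sqrt_eq_rpow, ← Real.rpow_natCast,
      ← Real.rpow_sub_one hn0.ne', ← Real.rpow_mul hn0.le]
    congr 1
    ring
  rw [upperBound, ← Nat.cast_sub hq, h3, h3, Real.sqrt_div' _ hn0.le]
  ring

lemma ceil_half (k : ℕ) : ⌈(k : ℝ) / 2⌉₊ = (k + 1) / 2 := by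
  rcases Nat.even_or_odd' k with ⟨m, rfl | rfl⟩
  · have h : ((2 * m : ℕ) : ℝ) / 2 = (m : ℕ) := by push_cast; ring
    rw [h, Nat.ceil_natCast]
    omega
  · have h : (2 * m + 1 + 1) / 2 = m + 1 := by omega
    rw [h, Nat.ceil_eq_iff (by omega)]
    push_cast
    constructor <;> linarith

/-- Both factors increase with max(q, k-q), which is least at ⌈k/2⌉. The product is monotone because
C ≤ n makes 1 - C/n^c nonnegative at the minimizer, whose exponent c is at least 1. -/
lemma isMinOn_lowerBound {C : ℝ} (hC : 0 ≤ C) (hn : 1 ≤ n) (hnC : C ≤ n) (hk : 1 ≤ k) :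
    IsMinOn (fun q : ℕ => lowerBound C k n q) (Set.Iic k) ⌈(k : ℝ) / 2⌉₊ := by
  intro q hq
  have hq' : q ≤ k := hq
  have hn1 : (1 : ℝ) ≤ n := by exact_mod_cast hn
  have hn0 : (0 : ℝ) < n := by linarith
  simp only [Set.mem_ofPred_eq]
  rw [ceil_half, lowerBound_eq hn (by omega), lowerBound_eq hn hq']
  set M := max q (k - q)
  set c := max ((k + 1) / 2) (k - (k + 1) / 2)
  have hcM : c ≤ M := by omega
  have hc1 : c ≠ 0 := by omega
  have hpow : (n : ℝ) ^ c ≤ (n : ℝ) ^ M := pow_le_pow_right₀ hn1 hcM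
  have hself : (n : ℝ) ≤ (n : ℝ) ^ c := le_self_pow₀ hn1 hc1
  refine mul_le_mul (Real.sqrt_le_sqrt (by gcongr)) ?_ ?_ (Real.sqrt_nonneg _)
  · have : C / (n : ℝ) ^ M ≤ C / (n : ℝ) ^ c := by gcongr
    linarith
  · rw [sub_nonneg, div_le_one (by positivity)]
    exact hnC.trans hself

/-- Convexity of the exponential: with a fixed sum of exponents, the more spread-out pair is larger.
For a = c + e and d = b + e the difference is (r^b - r^c)(r^e - 1). -/
lemma pow_add_pow_le {r : ℝ} (hr : 1 ≤ r) {a b c d : ℕ} (hab : a + b = c + d) (hbd : b ≤ d)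
    (had : a ≤ d) : r ^ a + r ^ b ≤ r ^ c + r ^ d := by
  obtain ⟨e, rfl⟩ := Nat.exists_eq_add_of_le hbd
  have ha : a = c + e := by omega
  subst ha
  have h1 : (1 : ℝ) ≤ r ^ e := one_le_pow₀ hr
  have h2 : r ^ c ≤ r ^ b := pow_le_pow_right₀ hr (by omega)
  rw [pow_add, pow_add]
  nlinarith

lemma isMinOn_upperBound (hn : 1 ≤ n) :
    IsMinOn (fun q : ℕ => upperBound k n q) (Set.Iic k) ⌈(k : ℝ) / 2⌉₊ := by
  intro q hq
  have hq' : q ≤ k := hq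
  have hn1 : (1 : ℝ) ≤ n := by exact_mod_cast hn
  simp only [Set.mem_ofPred_eq]
  rw [ceil_half, upperBound_eq hn (by omega), upperBound_eq hn hq']
  refine mul_le_mul_of_nonneg_left ?_ (Real.sqrt_nonneg _)
  have hs : ∀ m : ℕ, √((n : ℝ) ^ m) = √n ^ m := fun m => by
    rw [Real.sqrt_eq_iff_mul_self_eq (by positivity) (by positivity), ← mul_pow,
      Real.mul_self_sqrt (by positivity)]
  simp only [hs]
  have hr : 1 ≤ √(n : ℝ) := Real.one_le_sqrt.2 hn1
  rcases le_total q (k - q) with h | h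
  · exact pow_add_pow_le hr (by omega) (by omega) (by omega)
  · rw [add_comm (√(n : ℝ) ^ q)]
    exact pow_add_pow_le hr (by omega) (by omega) (by omega)

end Bounds

/-! ### Transfer to an arbitrary probability space, and the conclusion. -/

/-- A standard Gaussian tensor has the standard Gaussian law on the space of tensors. -/
lemma IsStdGaussianTensor.hasLaw_toLp {Ω : Type*} [MeasurableSpace Ω] {P : Measure Ω}
    [IsProbabilityMeasure P] {k n : ℕ} {G : Ω → Tensor k n} (hG : IsStdGaussianTensor G P) :
    HasLaw (fun ω => (WithLp.toLp 2 (G ω) : TensorSpace k n)) (stdGaussian (TensorSpace k n)) P := by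
  have hm : ∀ i, AEMeasurable (fun ω => G ω i) P := fun i => (hG.hasLaw i).aemeasurable
  have hGm : AEMeasurable G P := aemeasurable_pi_lambda _ hm
  refine ⟨by fun_prop, ?_⟩
  have h1 : P.map G = Measure.pi fun _ => gaussianReal 0 1 := by
    have h2 := (iIndepFun_iff_map_fun_eq_pi_map hm).1 hG.indep
    simp only [(hG.hasLaw _).map_eq] at h2
    exact h2
  rw [← map_pi_eq_stdGaussian, ← h1, AEMeasurable.map_map_of_aemeasurable (by fun_prop) hGm]
  rfl

end TensorUnfolding

theorem mainTheorem8 (k : ℕ) (hk : 1 ≤ k) :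
    ∃ C : ℝ, 0 < C ∧
      (∀ n : ℕ, 1 ≤ n → ∀ (Ω : Type*) [MeasurableSpace Ω] (P : Measure Ω) [IsProbabilityMeasure P]
        (G : Ω → TensorUnfolding.Tensor k n), TensorUnfolding.IsStdGaussianTensor G P →
        ∀ q : ℕ, q ≤ k →
          Integrable (fun ω => TensorUnfolding.noiseNorm q (G ω)) P ∧
          TensorUnfolding.lowerBound C k n q ≤ ∫ ω, TensorUnfolding.noiseNorm q (G ω) ∂P ∧
          ∫ ω, TensorUnfolding.noiseNorm q (G ω) ∂P ≤ TensorUnfolding.upperBound k n q ∧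
          ∀ t : ℝ, 0 ≤ t →
            P.real {ω | t ≤ |TensorUnfolding.noiseNorm q (G ω) -
                ∫ ω', TensorUnfolding.noiseNorm q (G ω') ∂P|} ≤
              2 * Real.exp (-((n : ℝ) * t ^ 2 / (2 * (k : ℝ))))) ∧
      (∀ᶠ n : ℕ in atTop,
        IsMinOn (fun q : ℕ => TensorUnfolding.lowerBound C k n q) (Set.Iic k) ⌈(k : ℝ) / 2⌉₊ ∧
        IsMinOn (fun q : ℕ => TensorUnfolding.upperBound k n q) (Set.Iic k) ⌈(k : ℝ) / 2⌉₊) := by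
  refine ⟨4 * (k ! : ℝ), by positivity, ?_, ?_⟩
  · intro n hn Ω _ P _ G hG q hq
    have hlaw := hG.hasLaw_toLp
    have hn0 : (0 : ℝ) < n := by exact_mod_cast hn
    have hk0 : (0 : ℝ) < k := by exact_mod_cast hk
    have hint := TensorUnfolding.integrable_noiseNorm hn hq
    have hE : ∫ ω, TensorUnfolding.noiseNorm q (G ω) ∂P =
        ∫ X, TensorUnfolding.noiseNorm q X.ofLp ∂(stdGaussian (TensorUnfolding.TensorSpace k n)) :=
      hlaw.integral_comp hint.aestronglyMeasurable
    have hsub := TensorUnfolding.hasSubgaussianMGF_noiseNorm hn hq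
    -- Integrability and sub-Gaussianity are pulled back to P by regarding the standard Gaussian as
    -- the law of G.
    rw [← hlaw.map_eq] at hint hsub
    refine ⟨hint.comp_aemeasurable hlaw.aemeasurable, ?_, ?_, fun t ht => ?_⟩
    · rw [hE, TensorUnfolding.lowerBound_eq hn hq]
      exact TensorUnfolding.le_integral_noiseNorm hk hn hq
    · rw [hE, TensorUnfolding.upperBound_eq hn hq]
      exact TensorUnfolding.integral_noiseNorm_le hn hq
    · have h1 := TensorUnfolding.measureReal_abs_ge_le
        (HasSubgaussianMGF.of_map hlaw.aemeasurable hsub) ht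
      rw [Real.coe_toNNReal _ (by positivity), hlaw.map_eq, ← hE] at h1
      refine h1.trans_eq ?_
      congr 2
      field_simp
  -- The threshold n ≥ C = 4 k! is needed for the lower bound; the upper bound is minimized at ⌈k/2⌉
  -- for every n ≥ 1.
  · filter_upwards [eventually_ge_atTop 1, eventually_ge_atTop (4 * k !)] with n hn hnC
    exact ⟨TensorUnfolding.isMinOn_lowerBound (by positivity) hn (by exact_mod_cast hnC) hk,
      TensorUnfolding.isMinOn_upperBound hn⟩
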